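/- Let $k$ be a field. A variety over $k$ is an integral separated scheme of finite type over $k$, and birational maps are over $k$. The exceptional locus $\operatorname{Exc}(f)\subset X$ of a birational map $f\colon X\dashrightarrow Y$ of varieties is the closed set of points of $X$ that have no open neighbourhood $U$ on which $f$ is defined and restricts to an isomorphism onto an open subscheme of $Y$. For an integer $\ell\ge 0$, $f$ is called an isomorphism in codimension $\ell$ if $\operatorname{Exc}(f)$ and $\operatorname{Exc}(f^{-1})$ have codimension $>\ell$ in $X$ and $Y$ respectively (the empty set has codimension $\infty$). Let $\operatorname{Bir}(X)$ be the group of birational transformations of $X$, let $\operatorname{Psaut}^{\ell}(X)\subset\operatorname{Bir}(X)$ be the set of those that are isomorphisms in codimension $\ell$, and for $g \in \operatorname{Bir}(X)$ let $\operatorname{Exc}^{\ell+1}(g)$ be the set of irreducible components of $\operatorname{Exc}(g)$ of codimension $\ell+1$ in $X$. **Proposition.** Let $X$ be a variety over $k$, let $0\le \ell\le \dim(X)-1$, and let $G\subset\operatorname{Psaut}^{\ell}(X)$ be a subgroup of $\operatorname{Bir}(X)$. Then the following are equivalent: 1. there exist a variety $Y$ over $k$ and a birational map $f\colon X\dashrightarrow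 Y$ that is an isomorphism in codimension $\ell$ such that $fGf^{-1}\subset\operatorname{Psaut}^{\ell+1}(Y)$; 2. there is an integer $N$ such that $|\operatorname{Exc}^{\ell+1}(g)|\le N$ for all $g\in G$. -/

import Mathlib

open CategoryTheory AlgebraicGeometry

universe u

namespace BirGeom

/-- A variety over `k`: an integral separated scheme of finite type over `Spec k`. -/
structure Variety (k : Type u) [Field k] where
  toScheme : Scheme.{u}
  str : toScheme ⟶ Spec (CommRingCat.of k)
  isIntegral : IsIntegral toScheme
  isSeparated : IsSeparated str
  locallyOfFiniteType : LocallyOfFiniteType str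
  quasiCompact : QuasiCompact str

namespace Variety

variable {k : Type u} [Field k]

instance (X : Variety k) : X.toScheme.Over (Spec (CommRingCat.of k)) := ⟨X.str⟩

instance (X : Variety k) : IsIntegral X.toScheme := X.isIntegral

end Variety

variable {k : Type u} [Field k]

/-- A birational map `X ⇢ Y` of varieties over `k`: a dominant rational map over `k` together with
its (unique) inverse. Composition of rational maps in Mathlib is written in diagrammatic order. -/
@[ext]
structure BirationalMap (X Y : Variety k) where
  hom : X.toScheme ⤏ Y.toScheme
  inv : Y.toScheme ⤏ X.toScheme
  hom_dominant : hom.IsDominant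
  inv_dominant : inv.IsDominant
  hom_isOver : hom.IsOver (Spec (CommRingCat.of k))
  inv_isOver : inv.IsOver (Spec (CommRingCat.of k))
  hom_inv : hom.comp inv = Scheme.RationalMap.id X.toScheme
  inv_hom : inv.comp hom = Scheme.RationalMap.id Y.toScheme

namespace BirationalMap

instance {X Y : Variety k} (f : BirationalMap X Y) : f.hom.IsDominant := f.hom_dominant

instance {X Y : Variety k} (f : BirationalMap X Y) : f.inv.IsDominant := f.inv_dominant

instance {X Y : Variety k} (f : BirationalMap X Y) :
    f.hom.IsOver (Spec (CommRingCat.of k)) := f.hom_isOver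

instance {X Y : Variety k} (f : BirationalMap X Y) :
    f.inv.IsOver (Spec (CommRingCat.of k)) := f.inv_isOver

/-- The inverse birational map. -/
def symm {X Y : Variety k} (f : BirationalMap X Y) : BirationalMap Y X where
  hom := f.inv
  inv := f.hom
  hom_dominant := f.inv_dominant
  inv_dominant := f.hom_dominant
  hom_isOver := f.inv_isOver
  inv_isOver := f.hom_isOver
  hom_inv := f.inv_hom
  inv_hom := f.hom_inv

theorem isDominant_id (X : Variety k) : (Scheme.RationalMap.id X.toScheme).IsDominant := by
  have h : IsDominant (X.toScheme.topIso.hom ≫ 𝟙 X.toScheme) := by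
    rw [Category.comp_id]
    infer_instance
  exact (Scheme.PartialMap.isDominant_toRationalMap_iff _).mpr h

/-- The identity. -/
noncomputable def refl (X : Variety k) : BirationalMap X X where
  hom := Scheme.RationalMap.id X.toScheme
  inv := Scheme.RationalMap.id X.toScheme
  hom_dominant := isDominant_id X
  inv_dominant := isDominant_id X
  hom_isOver := inferInstance
  inv_isOver := inferInstance
  hom_inv := Scheme.RationalMap.id_comp _
  inv_hom := Scheme.RationalMap.id_comp _

/-- `f.trans g` is the composition "first `f`, then `g`". -/
noncomputable def trans {X Y Z : Variety k} (f : BirationalMap X Y) (g : BirationalMap Y Z) :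
    BirationalMap X Z where
  hom := f.hom.comp g.hom
  inv := g.inv.comp f.inv
  hom_dominant := inferInstance
  inv_dominant := inferInstance
  hom_isOver := inferInstance
  inv_isOver := inferInstance
  hom_inv := by
    rw [Scheme.RationalMap.comp_assoc, ← Scheme.RationalMap.comp_assoc g.hom]
    simp only [g.hom_inv, Scheme.RationalMap.id_comp, f.hom_inv]
  inv_hom := by
    rw [Scheme.RationalMap.comp_assoc, ← Scheme.RationalMap.comp_assoc f.inv]
    simp only [f.inv_hom, Scheme.RationalMap.id_comp, g.inv_hom]

end BirationalMap

/-- The group `Bir(X)` of birational transformations of `X`. -/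
abbrev Bir (X : Variety k) := BirationalMap X X

/-- The product `f * g` is the composition `f ∘ g`, "first `g`, then `f`". -/
noncomputable instance (X : Variety k) : Group (Bir X) where
  mul f g := g.trans f
  one := BirationalMap.refl X
  inv f := f.symm
  mul_assoc f g h := BirationalMap.ext
    (Scheme.RationalMap.comp_assoc h.hom g.hom f.hom).symm
    (Scheme.RationalMap.comp_assoc f.inv g.inv h.inv)
  one_mul f := BirationalMap.ext (Scheme.RationalMap.comp_id f.hom)
    (Scheme.RationalMap.id_comp f.inv)
  mul_one f := BirationalMap.ext (Scheme.RationalMap.id_comp f.hom)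
    (Scheme.RationalMap.comp_id f.inv)
  inv_mul_cancel f := BirationalMap.ext f.hom_inv f.hom_inv

/-- The codimension of a subset `Z` of a topological space: the infimum of the codimensions of the
irreducible closed sets contained in `Z`. It is `⊤` for `Z = ∅`. -/
noncomputable def codim {T : Type*} [TopologicalSpace T] (Z : Set T) : ℕ∞ :=
  ⨅ (W : TopologicalSpace.IrreducibleCloseds T) (_ : (W : Set T) ⊆ Z), Order.coheight W

namespace BirationalMap

variable {X Y : Variety k}

/-- The exceptional locus of `f : X ⇢ Y`: the points of `X` with no open neighbourhood on which
`f` is defined and restricts to an isomorphism onto an open subscheme of `Y`. -/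
def exc (f : BirationalMap X Y) : Set X.toScheme :=
  {x | ¬ ∃ g : X.toScheme.PartialMap Y.toScheme,
    g.toRationalMap = f.hom ∧ IsOpenImmersion g.hom ∧ x ∈ g.domain}

theorem isClosed_exc (f : BirationalMap X Y) : IsClosed f.exc := by
  rw [← isOpen_compl_iff, isOpen_iff_forall_mem_open]
  intro x hx
  obtain ⟨g, h1, h2, h3⟩ := not_not.mp hx
  exact ⟨g.domain, fun y hy => not_not.mpr ⟨g, h1, h2, hy⟩, g.domain.isOpen, h3⟩

/-- `Exc^m(f)`: the set of irreducible components of codimension `m` of the exceptional locus. -/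
def excComponents (m : ℕ) (f : BirationalMap X Y) :
    Set (TopologicalSpace.IrreducibleCloseds X.toScheme) :=
  {W | Maximal (fun W' : TopologicalSpace.IrreducibleCloseds X.toScheme =>
      (W' : Set X.toScheme) ⊆ f.exc) W ∧ Order.coheight W = (m : ℕ∞)}

/-- `f : X ⇢ Y` is an isomorphism in codimension `l`: the exceptional loci of `f` and of `f⁻¹` have
codimension `> l` in `X` and `Y` respectively. -/
def IsIsoInCodim (l : ℕ) (f : BirationalMap X Y) : Prop :=
  (l : ℕ∞) < codim f.exc ∧ (l : ℕ∞) < codim f.symm.exc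

/-- The conjugate `f g f⁻¹ ∈ Bir(Y)` of `g ∈ Bir(X)` by `f : X ⇢ Y`. -/
noncomputable def conj (f : BirationalMap X Y) (g : Bir X) : Bir Y :=
  f.symm.trans (g.trans f)

end BirationalMap

/-- `Psaut^l(X)`: the birational transformations of `X` that are isomorphisms in codimension
`l`. -/
def Psaut (l : ℕ) (X : Variety k) : Set (Bir X) :=
  {g | g.IsIsoInCodim l}

/-- `G ⊆ Bir(X)` is pseudo-regularizable in codimension `m` by an isomorphism in codimension `l`:
there are a variety `Y` over `k` and an isomorphism in codimension `l`, `f : X ⇢ Y`, such that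
`f G f⁻¹ ⊆ Psaut^m(Y)`. -/
def IsPseudoRegularizableBy (m l : ℕ) {X : Variety k} (G : Subgroup (Bir X)) : Prop :=
  ∃ (Y : Variety k) (f : BirationalMap X Y), f.IsIsoInCodim l ∧
    ∀ g ∈ G, f.conj g ∈ Psaut m Y

end BirGeom

namespace AlgebraicGeometry.Scheme

open Limits

variable {D X Y Z : Scheme.{u}}

lemma Hom.toRationalMap_comp_toRationalMap [PreirreducibleSpace D] [Nonempty X]
    (i : D ⟶ X) [IsDominant i] (g : X ⟶ Z) :
    (Hom.toRationalMap i).comp (Hom.toRationalMap g) = Hom.toRationalMap (i ≫ g) := by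
  rw [RationalMap.comp_toRationalMap, ← RationalMap.compHom_toRationalMap,
    Hom.toPartialMap_compHom]

lemma RationalMap.eq_of_compHom_eq {a b : X ⤏ D} (i : D ⟶ Y) [Mono i]
    (h : a.compHom i = b.compHom i) : a = b := by
  obtain ⟨a, rfl⟩ := a.exists_rep
  obtain ⟨b, rfl⟩ := b.exists_rep
  rw [← RationalMap.compHom_toRationalMap, ← RationalMap.compHom_toRationalMap,
    PartialMap.toRationalMap_eq_iff] at h
  rw [PartialMap.toRationalMap_eq_iff]
  obtain ⟨W, hW, h₁, h₂, e⟩ := h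
  refine ⟨W, hW, h₁, h₂, ?_⟩
  simpa [PartialMap.restrict, PartialMap.compHom, ← Category.assoc, cancel_mono] using e

lemma Hom.toPartialMap_restrict_hom (f : X ⟶ Y) (W : X.Opens) (hW : Dense (W : Set X))
    (h : W ≤ f.toPartialMap.domain) : (f.toPartialMap.restrict W hW h).hom = W.ι ≫ f := by
  change X.homOfLE (le_top : W ≤ ⊤) ≫ (⊤ : X.Opens).ι ≫ f = W.ι ≫ f
  simp

lemma Hom.eq_of_toRationalMap_eq [IsReduced X] [Y.IsSeparated] {f g : X ⟶ Y}
    (h : Hom.toRationalMap f = Hom.toRationalMap g) : f = g := by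
  obtain ⟨W, hW, h₁, h₂, e⟩ := PartialMap.toRationalMap_eq_iff.mp h
  have : IsDominant W.ι := ⟨by simpa [DenseRange] using hW⟩
  rw [Hom.toPartialMap_restrict_hom, Hom.toPartialMap_restrict_hom] at e
  exact ext_of_isDominant W.ι e

/-- The inverse of a dominant open immersion, as a partial map. -/
@[simps]
noncomputable def Hom.openImmersionInv (i : D ⟶ X) [IsOpenImmersion i] [IsDominant i] :
    X.PartialMap D where
  domain := i.opensRange
  dense_domain := i.denseRange
  hom := i.isoOpensRange.inv

instance (i : D ⟶ X) [IsOpenImmersion i] [IsDominant i] :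
    IsDominant i.openImmersionInv.hom :=
  inferInstanceAs (IsDominant i.isoOpensRange.inv)

lemma Hom.openImmersionInv_compHom (i : D ⟶ X) [IsOpenImmersion i] [IsDominant i] :
    i.openImmersionInv.toRationalMap.compHom i = RationalMap.id X := by
  rw [← RationalMap.compHom_toRationalMap, PartialMap.toRationalMap_eq_iff]
  refine ⟨i.opensRange, i.denseRange, le_rfl, le_top, ?_⟩
  refine Eq.trans ?_ (Hom.toPartialMap_restrict_hom (𝟙 X) i.opensRange i.denseRange le_top).symm
  change X.homOfLE (le_refl i.opensRange) ≫ i.isoOpensRange.inv ≫ i = _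
  simp

lemma Hom.openImmersionInv_comp [PreirreducibleSpace X] [Nonempty D]
    (i : D ⟶ X) [IsOpenImmersion i] [IsDominant i] :
    i.openImmersionInv.toRationalMap.comp (Hom.toRationalMap i) = RationalMap.id X := by
  rw [RationalMap.comp_toRationalMap, Hom.openImmersionInv_compHom]

lemma Hom.comp_openImmersionInv [IrreducibleSpace X] [IrreducibleSpace D]
    (i : D ⟶ X) [IsOpenImmersion i] [IsDominant i] :
    (Hom.toRationalMap i).comp i.openImmersionInv.toRationalMap = RationalMap.id D := by
  apply RationalMap.eq_of_compHom_eq i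
  rw [← RationalMap.comp_toRationalMap, ← RationalMap.comp_toRationalMap,
    RationalMap.comp_assoc, Hom.openImmersionInv_comp]
  simp

lemma PartialMap.ι_comp [IrreducibleSpace X] (g : X.PartialMap Y)
    [IsDominant g.domain.ι] [IrreducibleSpace g.domain.toScheme] [Nonempty Y] :
    (Hom.toRationalMap g.domain.ι).comp g.toRationalMap = Hom.toRationalMap g.hom := by
  have h : g.toRationalMap =
      (Hom.openImmersionInv g.domain.ι).toRationalMap.comp (Hom.toRationalMap g.hom) := by
    rw [RationalMap.comp_toRationalMap, ← RationalMap.compHom_toRationalMap,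
      PartialMap.toRationalMap_eq_iff]
    refine ⟨g.domain, g.dense_domain, le_rfl, by simp, ?_⟩
    have key : X.homOfLE (show g.domain ≤ g.domain.ι.opensRange by simp) ≫
        (Hom.isoOpensRange g.domain.ι).inv = 𝟙 _ := by
      rw [← cancel_mono g.domain.ι]
      simp
    rw [PartialMap.restrict_id_hom, PartialMap.restrict_hom, PartialMap.compHom_hom,
      Hom.openImmersionInv_hom]
    exact ((Category.assoc _ _ _).symm.trans ((congrArg (· ≫ g.hom) key).trans
      (Category.id_comp _))).symm
  rw [h, ← RationalMap.comp_assoc]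
  simp only [Hom.comp_openImmersionInv, RationalMap.id_comp]

end AlgebraicGeometry.Scheme

namespace BirGeom
namespace Variety

variable {k : Type u} [Field k] (X : Variety k)

instance : AlgebraicGeometry.IsSeparated X.str := X.isSeparated
instance : LocallyOfFiniteType X.str := X.locallyOfFiniteType
instance : QuasiCompact X.str := X.quasiCompact
instance : X.toScheme.IsSeparated := ⟨by
  have : Limits.terminal.from X.toScheme =
    X.str ≫ Limits.terminal.from (Spec (CommRingCat.of k)) := Subsingleton.elim _ _
  rw [this]
  infer_instance⟩

end Variety

namespace BirationalMap

open Scheme Limits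

variable {k : Type u} [Field k] {X Y Z W : Variety k}

/-- A chart of a birational map `f : X ⇢ Y`: a nonempty scheme with open immersions into `X` and
`Y` over `k`, which correspond to each other under `f`. -/
structure Chart (f : BirationalMap X Y) where
  dom : Scheme.{u}
  isIntegral : IsIntegral dom
  fst : dom ⟶ X.toScheme
  snd : dom ⟶ Y.toScheme
  isOpenImmersion_fst : IsOpenImmersion fst
  isOpenImmersion_snd : IsOpenImmersion snd
  isDominant_fst : IsDominant fst
  fst_str : fst ≫ X.str = snd ≫ Y.str
  comp_hom : (Hom.toRationalMap fst).comp f.hom = Hom.toRationalMap snd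

namespace Chart

attribute [instance] isIntegral isOpenImmersion_fst isOpenImmersion_snd isDominant_fst

end Chart

lemma isDominant_of_isOpenImmersion {U V : Scheme.{u}} [IrreducibleSpace V] [Nonempty U]
    (i : U ⟶ V) [IsOpenImmersion i] : IsDominant i :=
  ⟨i.opensRange.isOpen.dense (Set.range_nonempty _)⟩

instance {f : BirationalMap X Y} (c : f.Chart) : IsDominant c.snd :=
  isDominant_of_isOpenImmersion _

/-- `f.Rel x y` means that `f` is a local isomorphism at `x` mapping `x` to `y`. -/
def Rel (f : BirationalMap X Y) (x : X.toScheme) (y : Y.toScheme) : Prop :=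
  ∃ (c : f.Chart) (d : c.dom), c.fst d = x ∧ c.snd d = y

/-- The inverse chart. -/
@[simps]
noncomputable def Chart.symm {f : BirationalMap X Y} (c : f.Chart) : f.symm.Chart where
  dom := c.dom
  isIntegral := inferInstance
  fst := c.snd
  snd := c.fst
  isOpenImmersion_fst := inferInstance
  isOpenImmersion_snd := inferInstance
  isDominant_fst := inferInstance
  fst_str := c.fst_str.symm
  comp_hom := by
    have h := congrArg (fun r => (Hom.toRationalMap c.fst).comp r) f.hom_inv
    simp only [← RationalMap.comp_assoc, c.comp_hom, RationalMap.comp_id] at h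
    exact h

/-- Restriction of a chart along an open immersion. -/
@[simps]
noncomputable def Chart.restrict {f : BirationalMap X Y} (c : f.Chart) {U : Scheme.{u}}
    [Nonempty U] (i : U ⟶ c.dom) [IsOpenImmersion i] : f.Chart :=
  have : IsDominant i := isDominant_of_isOpenImmersion i
  have : IsIntegral U := isIntegral_of_isOpenImmersion i
  { dom := U
    isIntegral := inferInstance
    fst := i ≫ c.fst
    snd := i ≫ c.snd
    isOpenImmersion_fst := inferInstance
    isOpenImmersion_snd := inferInstance
    isDominant_fst := inferInstance
    fst_str := by simp only [Category.assoc, c.fst_str]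
    comp_hom := by
      simp only [← Hom.toRationalMap_comp_toRationalMap, RationalMap.comp_assoc, c.comp_hom] }

/-- Composition of two charts whose middle maps agree. -/
@[simps]
noncomputable def Chart.trans {f : BirationalMap X Y} {g : BirationalMap Y Z} (c : f.Chart)
    (d : g.Chart) [Nonempty (pullback c.snd d.fst :)] : (f.trans g).Chart :=
  { dom := pullback c.snd d.fst
    isIntegral := isIntegral_of_isOpenImmersion (pullback.fst c.snd d.fst)
    fst := pullback.fst _ _ ≫ c.fst
    snd := pullback.snd _ _ ≫ d.snd
    isOpenImmersion_fst := inferInstance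
    isOpenImmersion_snd := inferInstance
    isDominant_fst := isDominant_of_isOpenImmersion _
    fst_str := by
      rw [Category.assoc, c.fst_str, pullback.condition_assoc, d.fst_str, Category.assoc]
    comp_hom := by
      have := isIntegral_of_isOpenImmersion (pullback.fst c.snd d.fst)
      have := isDominant_of_isOpenImmersion (pullback.fst c.snd d.fst)
      have := isDominant_of_isOpenImmersion (pullback.snd c.snd d.fst)
      have e : (Hom.toRationalMap (pullback.fst c.snd d.fst ≫ c.fst)).comp f.hom =
          Hom.toRationalMap (pullback.snd c.snd d.fst ≫ d.fst) :=
        (c.restrict (pullback.fst c.snd d.fst)).comp_hom.trans (by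
          rw [← pullback.condition]; rfl)
      change RationalMap.comp _ (f.hom.comp g.hom) = _
      rw [← RationalMap.comp_assoc]
      exact (by simp only [e] : _ = ((Hom.toRationalMap (pullback.snd c.snd d.fst ≫ d.fst)).comp
        g.hom)).trans (d.restrict (pullback.snd c.snd d.fst)).comp_hom }

lemma Rel.symm {f : BirationalMap X Y} {x : X.toScheme} {y : Y.toScheme} (h : f.Rel x y) :
    f.symm.Rel y x := by
  obtain ⟨c, d, rfl, rfl⟩ := h
  exact ⟨c.symm, d, rfl, rfl⟩

lemma Rel.trans {f : BirationalMap X Y} {g : BirationalMap Y Z} {x : X.toScheme} {y : Y.toScheme}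
    {z : Z.toScheme} (h : f.Rel x y) (h' : g.Rel y z) : (f.trans g).Rel x z := by
  obtain ⟨c, d, rfl, rfl⟩ := h
  obtain ⟨c', d', e, rfl⟩ := h'
  obtain ⟨p, hp, hp'⟩ := Scheme.Pullback.exists_preimage_pullback d d' e.symm
  have : Nonempty (pullback c.snd c'.fst :) := ⟨p⟩
  refine ⟨c.trans c', p, ?_, ?_⟩
  · exact (Hom.comp_apply _ _ _).trans (congrArg c.fst hp)
  · exact (Hom.comp_apply _ _ _).trans (congrArg c'.snd hp')

lemma rel_refl (x : X.toScheme) : (refl X).Rel x x :=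
  ⟨{ dom := X.toScheme
     isIntegral := inferInstance
     fst := 𝟙 _
     snd := 𝟙 _
     isOpenImmersion_fst := inferInstance
     isOpenImmersion_snd := inferInstance
     isDominant_fst := inferInstance
     fst_str := rfl
     comp_hom := RationalMap.comp_id _ }, x, rfl, rfl⟩

/-- Two morphisms factoring through charts of `f` and agreeing on `X` agree on `Y`. -/
lemma Chart.comp_snd_eq {f : BirationalMap X Y} (c c' : f.Chart) {U : Scheme.{u}} [IsIntegral U]
    (i : U ⟶ c.dom) (j : U ⟶ c'.dom) [IsDominant i] [IsDominant j] (h : i ≫ c.fst = j ≫ c'.fst) :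
    i ≫ c.snd = j ≫ c'.snd := by
  apply Hom.eq_of_toRationalMap_eq
  rw [← Hom.toRationalMap_comp_toRationalMap, ← Hom.toRationalMap_comp_toRationalMap,
    ← c.comp_hom, ← c'.comp_hom, ← RationalMap.comp_assoc, ← RationalMap.comp_assoc]
  simp only [Hom.toRationalMap_comp_toRationalMap, h]

lemma Rel.unique {f : BirationalMap X Y} {x : X.toScheme} {y y' : Y.toScheme} (h : f.Rel x y)
    (h' : f.Rel x y') : y = y' := by
  obtain ⟨c, d, rfl, rfl⟩ := h
  obtain ⟨c', d', e, rfl⟩ := h'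
  obtain ⟨p, hp, hp'⟩ := Scheme.Pullback.exists_preimage_pullback d d' e.symm
  have : Nonempty (pullback c.fst c'.fst :) := ⟨p⟩
  have := isIntegral_of_isOpenImmersion (pullback.fst c.fst c'.fst)
  have := isDominant_of_isOpenImmersion (pullback.fst c.fst c'.fst)
  have := isDominant_of_isOpenImmersion (pullback.snd c.fst c'.fst)
  have key := c.comp_snd_eq c' (pullback.fst c.fst c'.fst) (pullback.snd c.fst c'.fst)
    pullback.condition
  rw [← hp, ← hp', ← Hom.comp_apply, ← Hom.comp_apply, key]

lemma Rel.coheight_eq {f : BirationalMap X Y} {x : X.toScheme} {y : Y.toScheme} (h : f.Rel x y) :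
    Order.coheight x = Order.coheight y := by
  obtain ⟨c, d, rfl, rfl⟩ := h
  exact (coheight_eq_of_isOpenImmersion c.fst).trans (coheight_eq_of_isOpenImmersion c.snd).symm

instance isOver_openImmersionInv {S U V : Scheme.{u}} [U.Over S] [V.Over S] (i : U ⟶ V)
    [IsOpenImmersion i] [IsDominant i] [i.IsOver S] :
    i.openImmersionInv.toRationalMap.IsOver S := by
  have : i.openImmersionInv.IsOver S := ⟨by
    change i.isoOpensRange.inv ≫ U ↘ S = i.opensRange.ι ≫ V ↘ S
    rw [Iso.inv_comp_eq, ← comp_over i S, ← Category.assoc, Hom.isoOpensRange_hom_ι]⟩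
  infer_instance

/-- The birational map determined by a scheme with open immersions into `X` and `Y`. -/
noncomputable def ofSpan {D : Scheme.{u}} [Nonempty D] (i : D ⟶ X.toScheme) (j : D ⟶ Y.toScheme)
    [IsOpenImmersion i] [IsOpenImmersion j] (h : i ≫ X.str = j ≫ Y.str) : BirationalMap X Y :=
  have := isIntegral_of_isOpenImmersion i
  have := isDominant_of_isOpenImmersion i
  have := isDominant_of_isOpenImmersion j
  letI : D.Over (Spec (CommRingCat.of k)) := ⟨i ≫ X.str⟩
  have hi : i.IsOver (Spec (CommRingCat.of k)) := ⟨rfl⟩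
  have hj : j.IsOver (Spec (CommRingCat.of k)) := ⟨h.symm⟩
  { hom := i.openImmersionInv.toRationalMap.comp (Hom.toRationalMap j)
    inv := j.openImmersionInv.toRationalMap.comp (Hom.toRationalMap i)
    hom_dominant := inferInstance
    inv_dominant := inferInstance
    hom_isOver := inferInstance
    inv_isOver := inferInstance
    hom_inv := by
      rw [RationalMap.comp_assoc, ← RationalMap.comp_assoc (Hom.toRationalMap j)]
      simp only [Hom.comp_openImmersionInv, RationalMap.id_comp, Hom.openImmersionInv_comp]
    inv_hom := by
      rw [RationalMap.comp_assoc, ← RationalMap.comp_assoc (Hom.toRationalMap i)]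
      simp only [Hom.comp_openImmersionInv, RationalMap.id_comp, Hom.openImmersionInv_comp] }

/-- The span defining a birational map is a chart of it. -/
@[simps]
noncomputable def ofSpanChart {D : Scheme.{u}} [Nonempty D] (i : D ⟶ X.toScheme)
    (j : D ⟶ Y.toScheme) [IsOpenImmersion i] [IsOpenImmersion j] (h : i ≫ X.str = j ≫ Y.str) :
    (ofSpan i j h).Chart where
  dom := D
  isIntegral := isIntegral_of_isOpenImmersion i
  fst := i
  snd := j
  isOpenImmersion_fst := inferInstance
  isOpenImmersion_snd := inferInstance
  isDominant_fst := isDominant_of_isOpenImmersion i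
  fst_str := h
  comp_hom := by
    have := isIntegral_of_isOpenImmersion i
    have := isDominant_of_isOpenImmersion i
    change RationalMap.comp _ (i.openImmersionInv.toRationalMap.comp (Hom.toRationalMap j)) = _
    rw [← RationalMap.comp_assoc]
    simp only [Hom.comp_openImmersionInv, RationalMap.id_comp]

lemma Chart.hom_eq {f : BirationalMap X Y} (c : f.Chart) :
    f.hom = c.fst.openImmersionInv.toRationalMap.comp (Hom.toRationalMap c.snd) := by
  rw [← c.comp_hom, ← RationalMap.comp_assoc]
  simp only [Hom.openImmersionInv_comp, RationalMap.id_comp]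

/-- The chart given by a partial map which represents `f` and is an open immersion. -/
noncomputable def chartOfPartialMap {f : BirationalMap X Y}
    (g : X.toScheme.PartialMap Y.toScheme) (hg : g.toRationalMap = f.hom)
    [IsOpenImmersion g.hom] : f.Chart :=
  have : Nonempty g.domain := g.dense_domain.nonempty.to_subtype
  have : IsIntegral g.domain.toScheme := isIntegral_of_isOpenImmersion g.domain.ι
  { dom := g.domain
    isIntegral := inferInstance
    fst := g.domain.ι
    snd := g.hom
    isOpenImmersion_fst := inferInstance
    isOpenImmersion_snd := inferInstance
    isDominant_fst := isDominant_of_isOpenImmersion _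
    fst_str := by
      have : g.toRationalMap.IsOver (Spec (CommRingCat.of k)) := hg ▸ inferInstance
      have : g.IsOver (Spec (CommRingCat.of k)) :=
        PartialMap.isOver_toRationalMap_iff_of_isSeparated.mp this
      exact (comp_over g.hom (Spec (CommRingCat.of k))).symm
    comp_hom := by
      have := isDominant_of_isOpenImmersion g.domain.ι
      rw [← hg]
      exact g.ι_comp }

lemma notMem_exc_iff {f : BirationalMap X Y} {x : X.toScheme} : x ∉ f.exc ↔ ∃ y, f.Rel x y := by
  constructor
  · intro h
    obtain ⟨g, hg, hg', hx⟩ := not_not.mp h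
    exact ⟨_, chartOfPartialMap g hg, ⟨x, hx⟩, rfl, rfl⟩
  · rintro ⟨y, c, d, rfl, rfl⟩
    refine not_not.mpr ⟨c.fst.openImmersionInv.compHom c.snd, ?_, ?_, ?_⟩
    · rw [c.hom_eq, RationalMap.comp_toRationalMap, RationalMap.compHom_toRationalMap]
    · change IsOpenImmersion (c.fst.isoOpensRange.inv ≫ c.snd)
      infer_instance
    · exact ⟨d, rfl⟩

end BirationalMap
end BirGeom

namespace BirGeom

namespace BirationalMap

open Scheme Limits

variable {k : Type u} [Field k] {X Y Z W : Variety k}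

lemma trans_assoc (f : BirationalMap X Y) (g : BirationalMap Y Z) (h : BirationalMap Z W) :
    (f.trans g).trans h = f.trans (g.trans h) :=
  BirationalMap.ext (RationalMap.comp_assoc _ _ _) (RationalMap.comp_assoc _ _ _).symm

lemma self_trans_symm (f : BirationalMap X Y) : f.trans f.symm = refl X :=
  BirationalMap.ext f.hom_inv f.hom_inv

lemma symm_trans_self (f : BirationalMap X Y) : f.symm.trans f = refl Y :=
  f.symm.self_trans_symm

lemma trans_refl (f : BirationalMap X Y) : f.trans (refl Y) = f :=
  BirationalMap.ext (RationalMap.comp_id _) (RationalMap.id_comp _)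

lemma refl_trans (f : BirationalMap X Y) : (refl X).trans f = f :=
  BirationalMap.ext (RationalMap.id_comp _) (RationalMap.comp_id _)

lemma Rel.notMem_exc {f : BirationalMap X Y} {x : X.toScheme} {y : Y.toScheme} (h : f.Rel x y) :
    x ∉ f.exc :=
  notMem_exc_iff.mpr ⟨y, h⟩

/-- A birational map which is a local isomorphism somewhere has a chart whose range is the whole
complement of the exceptional locus. -/
lemma exists_chart_range_fst_eq (f : BirationalMap X Y) (h : f.excᶜ.Nonempty) :
    ∃ c : f.Chart, Set.range c.fst = f.excᶜ := by
  let E : X.toScheme.Opens := ⟨f.excᶜ, f.isClosed_exc.isOpen_compl⟩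
  have hE : Dense (E : Set X.toScheme) := E.isOpen.dense h
  have hle : E ≤ f.hom.toPartialMap.domain := by
    intro x hx
    obtain ⟨g, hg, -, hx⟩ := not_not.mp hx
    exact RationalMap.mem_domain.mpr ⟨g, hx, hg⟩
  let g : X.toScheme.PartialMap Y.toScheme := f.hom.toPartialMap.restrict E hE hle
  have hg : g.toRationalMap = f.hom := by
    rw [PartialMap.restrict_toRationalMap, RationalMap.toRationalMap_toPartialMap]
  have : Nonempty g.domain := g.dense_domain.nonempty.to_subtype
  have : IsIntegral g.domain.toScheme := isIntegral_of_isOpenImmersion g.domain.ι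
  have := isDominant_of_isOpenImmersion g.domain.ι
  have hcomp : (Hom.toRationalMap g.domain.ι).comp f.hom = Hom.toRationalMap g.hom :=
    hg ▸ g.ι_comp
  have key (c : f.Chart) : ∃ i : c.dom ⟶ g.domain, IsOpenImmersion i ∧
      i ≫ g.domain.ι = c.fst ∧ i ≫ g.hom = c.snd := by
    have hr : Set.range c.fst ⊆ Set.range g.domain.ι := by
      rintro _ ⟨d, rfl⟩
      have : c.fst d ∉ f.exc := Rel.notMem_exc ⟨c, d, rfl, rfl⟩
      simpa [g] using (show c.fst d ∈ E from this)
    have e : IsOpenImmersion.lift g.domain.ι c.fst hr ≫ g.domain.ι = c.fst :=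
      IsOpenImmersion.lift_fac _ _ _
    generalize IsOpenImmersion.lift g.domain.ι c.fst hr = i at e
    have : IsOpenImmersion (i ≫ g.domain.ι) := e ▸ inferInstance
    have := IsOpenImmersion.of_comp i g.domain.ι
    have := isDominant_of_isOpenImmersion i
    refine ⟨i, inferInstance, e, Hom.eq_of_toRationalMap_eq ?_⟩
    rw [← Hom.toRationalMap_comp_toRationalMap, ← hcomp, ← RationalMap.comp_assoc, ← c.comp_hom]
    simp only [Hom.toRationalMap_comp_toRationalMap, e]
  have hrel (d : g.domain) : f.Rel (g.domain.ι d) (g.hom d) := by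
    obtain ⟨y, c, d', h₁, -⟩ := notMem_exc_iff.mp (show g.domain.ι d ∉ f.exc from d.2)
    obtain ⟨i, -, e₁, e₂⟩ := key c
    refine ⟨c, d', h₁, ?_⟩
    have : i d' = d := g.domain.ι.isOpenEmbedding.injective (by
      rw [← h₁, ← e₁, Hom.comp_apply])
    rw [← this, ← e₂, Hom.comp_apply]
  have : IsOpenImmersion g.hom := by
    refine IsOpenImmersion.of_forall_source_exists _ (fun d d' h => ?_) fun d => ?_
    · refine g.domain.ι.isOpenEmbedding.injective ?_
      exact (hrel d).symm.unique (h ▸ (hrel d').symm)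
    · obtain ⟨c, d', h₁, -⟩ := hrel d
      obtain ⟨i, hi, e₁, e₂⟩ := key c
      refine ⟨c.dom, i, hi, ⟨d', g.domain.ι.isOpenEmbedding.injective ?_⟩, by rw [e₂]; infer_instance⟩
      rw [← h₁, ← e₁, Hom.comp_apply]
  refine ⟨chartOfPartialMap g hg, ?_⟩
  change Set.range g.domain.ι = _
  simp [g, E]

/-- The graph of a chart, as a morphism to the fibre product. -/
noncomputable def Chart.graph {f : BirationalMap X Y} (c : f.Chart) :
    c.dom ⟶ pullback X.str Y.str :=
  pullback.lift c.fst c.snd c.fst_str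

@[simp]
lemma Chart.graph_fst {f : BirationalMap X Y} (c : f.Chart) :
    c.graph ≫ pullback.fst X.str Y.str = c.fst := pullback.lift_fst _ _ _

@[simp]
lemma Chart.graph_snd {f : BirationalMap X Y} (c : f.Chart) :
    c.graph ≫ pullback.snd X.str Y.str = c.snd := pullback.lift_snd _ _ _

/-- If two morphisms to a separated scheme agree on `T`, then any point of the closure of `T` lifts
to their equalizer. -/
lemma exists_equalizer_of_mem_closure {N V T : Scheme.{u}} [V.IsSeparated] (a b : N ⟶ V)
    (t : T ⟶ N) (h : t ≫ a = t ≫ b) {z : N} (hz : z ∈ closure (Set.range t)) :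
    ∃ e : (equalizer a b :), equalizer.ι a b e = z := by
  have h₁ : Set.range t ⊆ Set.range (equalizer.ι a b) := by
    rintro _ ⟨d, rfl⟩
    exact ⟨equalizer.lift t h d, by rw [← Hom.comp_apply, equalizer.lift_ι]⟩
  exact closure_minimal h₁ (equalizer.ι a b).isClosedEmbedding.isClosed_range hz

lemma closure_range_pullback_snd {N P T : Scheme.{u}} (t : T ⟶ P) (n : N ⟶ P) [IsOpenImmersion n]
    {z : N} (hz : n z ∈ closure (Set.range t)) :
    z ∈ closure (Set.range (pullback.snd t n)) := by
  rw [Scheme.Pullback.range_snd]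
  exact n.isOpenEmbedding.isOpenMap.preimage_closure_subset_closure_preimage hz

/-- The graph of a chart is closed in the preimage of the domain of the chart. -/
lemma Chart.mem_range_graph_of_fst {f : BirationalMap X Y} (c : f.Chart)
    {z : (pullback X.str Y.str :)} (hz : z ∈ closure (Set.range c.graph))
    (h : pullback.fst X.str Y.str z ∈ Set.range c.fst) : z ∈ Set.range c.graph := by
  obtain ⟨d, hd⟩ := h
  obtain ⟨n, hn, hn'⟩ := Scheme.Pullback.exists_preimage_pullback d z hd
  let p := pullback.fst c.fst (pullback.fst X.str Y.str)
  let q := pullback.snd c.fst (pullback.fst X.str Y.str)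
  have hpq : p ≫ c.fst = q ≫ pullback.fst X.str Y.str := pullback.condition
  have hT := closure_range_pullback_snd c.graph q (z := n) (by rwa [hn'])
  have e : pullback.snd c.graph q ≫ p = pullback.fst c.graph q := by
    rw [← cancel_mono c.fst, Category.assoc, hpq, ← pullback.condition_assoc, c.graph_fst]
  obtain ⟨e, he⟩ := exists_equalizer_of_mem_closure (p ≫ c.snd) (q ≫ pullback.snd X.str Y.str)
    (pullback.snd c.graph q) (by rw [← Category.assoc, e, ← pullback.condition_assoc, c.graph_snd]) hT
  refine ⟨p (equalizer.ι (p ≫ c.snd) (q ≫ pullback.snd X.str Y.str) e), ?_⟩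
  have : equalizer.ι (p ≫ c.snd) (q ≫ pullback.snd X.str Y.str) ≫ p ≫ c.graph =
      equalizer.ι (p ≫ c.snd) (q ≫ pullback.snd X.str Y.str) ≫ q := by
    apply pullback.hom_ext
    · simp only [Category.assoc, c.graph_fst, hpq]
    · simp only [Category.assoc, c.graph_snd]
      exact equalizer.condition _ _
  rw [← Hom.comp_apply, ← Hom.comp_apply, this, Hom.comp_apply, he, hn']

lemma toRationalMap_comp_congr {U V W : Scheme.{u}} [IsIntegral U] [Nonempty V] {i j : U ⟶ V}
    [IsDominant i] [IsDominant j] (h : i = j) (r : V ⤏ W) :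
    (Hom.toRationalMap i).comp r = (Hom.toRationalMap j).comp r := by
  subst h
  rfl

lemma Chart.eq_of_mem_closure {f : BirationalMap X Y} (c : f.Chart)
    {β : BirationalMap Y W} {z : (pullback X.str Y.str :)}
    (hz : z ∈ closure (Set.range c.graph)) {w w' : W.toScheme}
    (h : (f.trans β).Rel (pullback.fst X.str Y.str z) w) (h' : β.Rel (pullback.snd X.str Y.str z) w') :
    w = w' := by
  obtain ⟨a, d, hd, rfl⟩ := h
  obtain ⟨b, d', hd', rfl⟩ := h'
  let n := pullback.map (a.fst ≫ X.str) (b.fst ≫ Y.str) X.str Y.str a.fst b.fst (𝟙 _)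
    (by simp) (by simp)
  have hz' : z ∈ Set.range n := by
    rw [Scheme.Pullback.range_map]
    exact ⟨⟨d, hd⟩, ⟨d', hd'⟩⟩
  obtain ⟨z, rfl⟩ := hz'
  let p := pullback.fst (a.fst ≫ X.str) (b.fst ≫ Y.str)
  let q := pullback.snd (a.fst ≫ X.str) (b.fst ≫ Y.str)
  have hp : n ≫ pullback.fst X.str Y.str = p ≫ a.fst := pullback.lift_fst _ _ _
  have hq : n ≫ pullback.snd X.str Y.str = q ≫ b.fst := pullback.lift_snd _ _ _
  rw [← Hom.comp_apply, hp, Hom.comp_apply] at hd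
  rw [← Hom.comp_apply, hq, Hom.comp_apply] at hd'
  have hd := a.fst.isOpenEmbedding.injective hd
  have hd' := b.fst.isOpenEmbedding.injective hd'
  have hT := closure_range_pullback_snd c.graph n hz
  have : Nonempty (pullback c.graph n :) := by
    have : (Set.range (pullback.snd c.graph n)).Nonempty := closure_nonempty_iff.mp ⟨_, hT⟩
    exact Set.range_nonempty_iff_nonempty.mp this
  let r := pullback.fst c.graph n
  let t := pullback.snd c.graph n
  have hr : r ≫ c.fst = (t ≫ p) ≫ a.fst := by
    rw [Category.assoc, ← hp, ← pullback.condition_assoc, c.graph_fst]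
  have hr' : r ≫ c.snd = (t ≫ q) ≫ b.fst := by
    rw [Category.assoc, ← hq, ← pullback.condition_assoc, c.graph_snd]
  have : IsOpenImmersion ((t ≫ p) ≫ a.fst) := by rw [← hr]; infer_instance
  have : IsOpenImmersion (t ≫ p) := IsOpenImmersion.of_comp _ a.fst
  have : IsOpenImmersion ((t ≫ q) ≫ b.fst) := by rw [← hr']; infer_instance
  have : IsOpenImmersion (t ≫ q) := IsOpenImmersion.of_comp _ b.fst
  have key : t ≫ p ≫ a.snd = t ≫ q ≫ b.snd := by
    have : IsIntegral (pullback c.graph n) := isIntegral_of_isOpenImmersion r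
    apply Hom.eq_of_toRationalMap_eq
    rw [← Category.assoc, ← Category.assoc]
    refine (a.restrict (t ≫ p)).comp_hom.symm.trans
      (Eq.trans ?_ (b.restrict (t ≫ q)).comp_hom)
    have := isDominant_of_isOpenImmersion ((t ≫ p) ≫ a.fst)
    have : IsDominant (r ≫ c.fst) := hr ▸ this
    have : IsDominant (r ≫ c.snd) := hr' ▸ isDominant_of_isOpenImmersion ((t ≫ q) ≫ b.fst)
    have := isDominant_of_isOpenImmersion ((t ≫ q) ≫ b.fst)
    refine (toRationalMap_comp_congr hr.symm (f.hom.comp β.hom)).trans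
      (Eq.trans ?_ (toRationalMap_comp_congr hr' β.hom))
    rw [← RationalMap.comp_assoc]
    have e : (Hom.toRationalMap (r ≫ c.fst)).comp f.hom = Hom.toRationalMap (r ≫ c.snd) :=
      (c.restrict r).comp_hom
    simp only [e]
  obtain ⟨e, he⟩ := exists_equalizer_of_mem_closure _ _ t key hT
  rw [hd, hd', ← he]
  simp only [← Hom.comp_apply]
  rw [Category.assoc, Category.assoc, equalizer.condition]

/-- Let `(p, q)` be a point in the closure of the graph of `f : X ⇢ Y`. If `X` and `Y` are
locally isomorphic at `p` and `q` to the same variety, compatibly with `f`, then `f` is a local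
isomorphism at `p` mapping `p` to `q`. -/
lemma Chart.rel_of_mem_closure {f : BirationalMap X Y} (c : f.Chart) {α : BirationalMap X W}
    {β : BirationalMap Y W} (hαβ : f.trans β = α) {z : (pullback X.str Y.str :)}
    (hz : z ∈ closure (Set.range c.graph)) {w w' : W.toScheme}
    (h : α.Rel (pullback.fst X.str Y.str z) w) (h' : β.Rel (pullback.snd X.str Y.str z) w') :
    f.Rel (pullback.fst X.str Y.str z) (pullback.snd X.str Y.str z) := by
  subst hαβ
  obtain rfl := c.eq_of_mem_closure hz h h'
  simpa only [trans_assoc, self_trans_symm, trans_refl] using h.trans h'.symm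

end BirationalMap
end BirGeom

namespace BirGeom

open Scheme Limits

section Gluing

variable {D U V Z S : Scheme.{u}} (i : D ⟶ U) (j : D ⟶ V) [IsOpenImmersion i] [IsOpenImmersion j]

instance isOpenImmersion_pushout_inl : IsOpenImmersion (pushout.inl i j) :=
  inferInstanceAs (IsOpenImmersion (colimit.ι (span i j) WalkingSpan.left))

instance isOpenImmersion_pushout_inr : IsOpenImmersion (pushout.inr i j) :=
  inferInstanceAs (IsOpenImmersion (colimit.ι (span i j) WalkingSpan.right))

lemma pushout_jointly_surjective (z : (pushout i j :)) :
    (∃ u, pushout.inl i j u = z) ∨ ∃ v, pushout.inr i j v = z := by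
  obtain ⟨a, x, hx⟩ := IsLocallyDirected.ι_jointly_surjective (span i j) z
  rcases a with _ | _ | _
  · have e : i ≫ pushout.inl i j = colimit.ι (span i j) none :=
      colimit.w (span i j) WalkingSpan.Hom.fst
    let x' : D := x
    exact Or.inl ⟨i x', (Hom.comp_apply i (pushout.inl i j) x').symm.trans
      ((congrArg (fun f : D ⟶ pushout i j => f x') e).trans hx)⟩
  · exact Or.inl ⟨x, hx⟩
  · exact Or.inr ⟨x, hx⟩

lemma eq_none_or_eq_of_hom {J : Type*} {a b : WidePushoutShape J} (f : a ⟶ b) :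
    a = none ∨ a = b := by
  obtain (_ | _) := f
  · exact Or.inr rfl
  · exact Or.inl rfl

lemma exists_of_pushout_inl_eq_inr {u : U} {v : V} (h : pushout.inl i j u = pushout.inr i j v) :
    ∃ d, i d = u ∧ j d = v := by
  obtain ⟨a, f, g, x, h₁, h₂⟩ := (IsLocallyDirected.ι_eq_ι_iff (span i j)
    (i := WalkingSpan.left) (j := WalkingSpan.right)).mp h
  rcases a with _ | _ | _
  · obtain rfl : f = WalkingSpan.Hom.fst := Subsingleton.elim _ _
    obtain rfl : g = WalkingSpan.Hom.snd := Subsingleton.elim _ _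
    exact ⟨x, h₁, h₂⟩
  · rcases eq_none_or_eq_of_hom g with h | h <;> cases h
  · rcases eq_none_or_eq_of_hom f with h | h <;> cases h

end Gluing

section Separated

variable {D U V Z S : Scheme.{u}} {i : D ⟶ U} {j : D ⟶ V}

/-- The preimage of the diagonal of `Z` in the product of two open subschemes `A` and `B`. -/
lemma preimage_range_diagonal {A B E : Scheme.{u}} (s : Z ⟶ S) (a : A ⟶ Z) (b : B ⟶ Z)
    [IsOpenImmersion a] [IsOpenImmersion b] (sA : A ⟶ S) (sB : B ⟶ S) (hA : sA = a ≫ s)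
    (hB : sB = b ≫ s) (e : E ⟶ A) (e' : E ⟶ B) (h : e ≫ a = e' ≫ b) (h' : e ≫ sA = e' ≫ sB)
    (hE : ∀ x y, a x = b y → ∃ d, e d = x ∧ e' d = y) :
    (pullback.map sA sB s s a b (𝟙 _) (by simp [hA]) (by simp [hB])) ⁻¹'
      Set.range (pullback.diagonal s) = Set.range (pullback.lift e e' h') := by
  subst hA hB
  let m := pullback.map (a ≫ s) (b ≫ s) s s a b (𝟙 _) (by simp) (by simp)
  let l := pullback.lift e e' h'
  have hm : m ≫ pullback.fst s s = pullback.fst _ _ ≫ a := pullback.lift_fst _ _ _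
  have hm' : m ≫ pullback.snd s s = pullback.snd _ _ ≫ b := pullback.lift_snd _ _ _
  have hl : l ≫ m = (e ≫ a) ≫ pullback.diagonal s := by
    apply pullback.hom_ext
    · rw [Category.assoc, hm, pullback.lift_fst_assoc]
      simp
    · rw [Category.assoc, hm', pullback.lift_snd_assoc]
      simp [h]
  ext p
  constructor
  · rintro ⟨w, hw⟩
    change pullback.diagonal s w = m p at hw
    have h₁ : w = a (pullback.fst (a ≫ s) (b ≫ s) p) := by
      rw [← Hom.comp_apply, ← hm, Hom.comp_apply, ← hw, ← Hom.comp_apply, pullback.diagonal_fst]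
      rfl
    have h₂ : w = b (pullback.snd (a ≫ s) (b ≫ s) p) := by
      rw [← Hom.comp_apply, ← hm', Hom.comp_apply, ← hw, ← Hom.comp_apply, pullback.diagonal_snd]
      rfl
    obtain ⟨d, hd, -⟩ := hE _ _ (h₁.symm.trans h₂)
    refine ⟨d, m.isOpenEmbedding.injective ?_⟩
    change m (l d) = m p
    rw [← Hom.comp_apply, hl, ← hw, h₁, ← hd, Hom.comp_apply, Hom.comp_apply]
  · rintro ⟨d, rfl⟩
    refine ⟨(e ≫ a) d, ?_⟩
    rw [← Hom.comp_apply, ← hl, Hom.comp_apply]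

lemma isClosed_of_forall_preimage {T : Type*} [TopologicalSpace T] {ι : Type*} {M : ι → Type*}
    [∀ i, TopologicalSpace (M i)] (m : ∀ i, M i → T) (hm : ∀ i, IsOpenMap (m i))
    (h : ∀ t, ∃ i x, m i x = t) {C : Set T} (hC : ∀ i, IsClosed (m i ⁻¹' C)) : IsClosed C := by
  rw [← isOpen_compl_iff]
  have : Cᶜ = ⋃ i, m i '' (m i ⁻¹' C)ᶜ := by
    ext t
    simp only [Set.mem_iUnion, Set.mem_image, Set.mem_compl_iff, Set.mem_preimage]
    constructor
    · intro ht
      obtain ⟨i, x, rfl⟩ := h t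
      exact ⟨i, x, ht, rfl⟩
    · rintro ⟨i, x, hx, rfl⟩
      exact hx
  rw [this]
  exact isOpen_iUnion fun i => hm i _ (hC i).isOpen_compl

/-- Gluing two separated schemes along open subschemes gives a separated scheme if the graph of
the identification is closed. -/
lemma isSeparated_of_cover (s : Z ⟶ S) (a : U ⟶ Z) (b : V ⟶ Z)
    [IsOpenImmersion a] [IsOpenImmersion b] (sU : U ⟶ S) (sV : V ⟶ S) [IsSeparated sU]
    [IsSeparated sV] (hU : sU = a ≫ s) (hV : sV = b ≫ s)
    (h : i ≫ a = j ≫ b) (h' : i ≫ sU = j ≫ sV) (hab : ∀ z, (∃ u, a u = z) ∨ ∃ v, b v = z)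
    (hD : ∀ x y, a x = b y → ∃ d, i d = x ∧ j d = y)
    (hc : IsClosed (Set.range (pullback.lift i j h'))) :
    IsSeparated s := by
  constructor
  refine IsClosedImmersion.of_isPreimmersion _ ?_
  have haa := preimage_range_diagonal s a a sU sU hU hU (𝟙 U) (𝟙 U) rfl rfl
    fun x y h => ⟨x, rfl, a.isOpenEmbedding.injective h⟩
  have hbb := preimage_range_diagonal s b b sV sV hV hV (𝟙 V) (𝟙 V) rfl rfl
    fun x y h => ⟨x, rfl, b.isOpenEmbedding.injective h⟩
  have hab' := preimage_range_diagonal s a b sU sV hU hV i j h h' hD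
  have hba' := preimage_range_diagonal s b a sV sU hV hU j i h.symm h'.symm
    fun x y h => (hD y x h.symm).imp fun _ => And.symm
  let A : Bool → Scheme.{u} := fun t => bif t then U else V
  let α : ∀ t, A t ⟶ Z := fun t => match t with | true => a | false => b
  have hα : ∀ t, IsOpenImmersion (α t) := by rintro (_ | _) <;> assumption
  let σA : ∀ t, A t ⟶ S := fun t => match t with | true => sU | false => sV
  have hσ : ∀ t, σA t = α t ≫ s := by rintro (_ | _) <;> assumption
  let m (t : Bool × Bool) := pullback.map (σA t.1) (σA t.2) s s (α t.1) (α t.2) (𝟙 _)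
    (by simp [hσ]) (by simp [hσ])
  refine isClosed_of_forall_preimage (fun t => m t) (fun t => (m t).isOpenEmbedding.isOpenMap)
    ?_ ?_
  · have hZ (z : Z) : ∃ t x, α t x = z := by
      obtain h | h := hab z
      · exact ⟨true, h⟩
      · exact ⟨false, h⟩
    intro t
    obtain ⟨t₁, x₁, h₁⟩ := hZ (pullback.fst s s t)
    obtain ⟨t₂, x₂, h₂⟩ := hZ (pullback.snd s s t)
    have : t ∈ Set.range (m (t₁, t₂)) := by
      rw [Scheme.Pullback.range_map]
      exact ⟨⟨x₁, h₁⟩, ⟨x₂, h₂⟩⟩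
    exact ⟨(t₁, t₂), this⟩
  · rintro ⟨_ | _, _ | _⟩
    · exact hbb ▸ (pullback.diagonal sV).isClosedEmbedding.isClosed_range
    · refine hba' ▸ ?_
      let σ := (pullbackSymmetry sU sV).hom
      have e : pullback.lift j i h'.symm = pullback.lift i j h' ≫ σ := by
        apply pullback.hom_ext
        · rw [Category.assoc, pullbackSymmetry_hom_comp_fst, pullback.lift_fst, pullback.lift_snd]
        · rw [Category.assoc, pullbackSymmetry_hom_comp_snd, pullback.lift_fst, pullback.lift_snd]
      rw [e, Hom.comp_base, TopCat.coe_comp, Set.range_comp]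
      exact σ.isClosedEmbedding.isClosedMap _ hc
    · exact hab' ▸ hc
    · exact haa ▸ (pullback.diagonal sU).isClosedEmbedding.isClosed_range

end Separated

variable {k : Type u} [Field k]

lemma Variety.isNoetherian (X : Variety k) : IsNoetherian X.toScheme := by
  have : IsLocallyNoetherian X.toScheme := LocallyOfFiniteType.isLocallyNoetherian X.str
  have : CompactSpace X.toScheme := (quasiCompact_iff_compactSpace X.str).mp inferInstance
  exact {}

instance (X Y : Variety k) :
    TopologicalSpace.NoetherianSpace (pullback X.str Y.str :) := by
  have : IsNoetherian X.toScheme := X.isNoetherian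
  have : IsLocallyNoetherian (pullback X.str Y.str) :=
    LocallyOfFiniteType.isLocallyNoetherian (pullback.fst X.str Y.str)
  have : CompactSpace (pullback X.str Y.str :) :=
    (quasiCompact_iff_compactSpace (pullback.fst X.str Y.str)).mp inferInstance
  have : IsNoetherian (pullback X.str Y.str) := {}
  infer_instance

instance (X : Variety k) : TopologicalSpace.NoetherianSpace X.toScheme :=
  have := X.isNoetherian
  inferInstance

/-- A nonempty open subscheme of a variety. -/
@[simps]
noncomputable def Variety.ofOpen (X : Variety k) (U : X.toScheme.Opens) [Nonempty U] :
    Variety k where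
  toScheme := U
  str := U.ι ≫ X.str
  isIntegral := isIntegral_of_isOpenImmersion U.ι
  isSeparated := inferInstance
  locallyOfFiniteType := inferInstance
  quasiCompact := by
    have := X.isNoetherian
    have : QuasiCompact U.ι := inferInstance
    infer_instance

/-- Two varieties can be glued along an open subscheme whose graph is closed. -/
lemma Variety.exists_glue (U V : Variety k) {D : Scheme.{u}} [Nonempty D] (i : D ⟶ U.toScheme)
    (j : D ⟶ V.toScheme) [IsOpenImmersion i] [IsOpenImmersion j] (h : i ≫ U.str = j ≫ V.str)
    (hc : IsClosed (Set.range (pullback.lift i j h))) :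
    ∃ (Z : Variety k) (a : U.toScheme ⟶ Z.toScheme) (b : V.toScheme ⟶ Z.toScheme),
      IsOpenImmersion a ∧ IsOpenImmersion b ∧ a ≫ Z.str = U.str ∧ b ≫ Z.str = V.str ∧
      i ≫ a = j ≫ b ∧ ∀ z, (∃ u, a u = z) ∨ ∃ v, b v = z := by
  let Z := pushout i j
  let a : U.toScheme ⟶ Z := pushout.inl i j
  let b : V.toScheme ⟶ Z := pushout.inr i j
  have ha : IsOpenImmersion a := isOpenImmersion_pushout_inl i j
  have hb : IsOpenImmersion b := isOpenImmersion_pushout_inr i j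
  let s : Z ⟶ Spec (CommRingCat.of k) := pushout.desc U.str V.str h
  have has : a ≫ s = U.str := pushout.inl_desc _ _ _
  have hbs : b ≫ s = V.str := pushout.inr_desc _ _ _
  have hij : i ≫ a = j ≫ b := pushout.condition
  have hab : ∀ z : Z, (∃ u, a u = z) ∨ ∃ v, b v = z := pushout_jointly_surjective i j
  have hsep : IsSeparated s := by
    exact isSeparated_of_cover s a b _ _ has.symm hbs.symm hij h hab
      (fun x y h => exists_of_pushout_inl_eq_inr i j h) hc
  have hcov : Set.range a ∪ Set.range b = Set.univ := by
    ext z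
    simpa using hab z
  have hirr : IrreducibleSpace Z := by
    have : IsDominant i := BirationalMap.isDominant_of_isOpenImmersion i
    have : IsDominant j := BirationalMap.isDominant_of_isOpenImmersion j
    have : IsIntegral D := isIntegral_of_isOpenImmersion i
    have h₁ : IsIrreducible (closure (Set.range (i ≫ a))) := by
      rw [← Set.image_univ]
      exact ((IrreducibleSpace.isIrreducible_univ D).image _
        (i ≫ a).continuous.continuousOn).closure
    have h₂ : closure (Set.range (i ≫ a)) = Set.univ := by
      refine Set.eq_univ_of_forall fun z => ?_
      obtain ⟨u, rfl⟩ | ⟨v, rfl⟩ := hab z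
      · refine map_mem_closure a.continuous (i.denseRange u) ?_
        rintro _ ⟨d, rfl⟩
        exact ⟨d, Hom.comp_apply _ _ _⟩
      · refine map_mem_closure b.continuous (j.denseRange v) ?_
        rintro _ ⟨d, rfl⟩
        exact ⟨d, by rw [hij, Hom.comp_apply]⟩
    rw [h₂] at h₁
    exact (irreducibleSpace_def Z).mpr h₁
  let 𝒰 : Z.OpenCover :=
    { I₀ := Bool
      X := fun t => bif t then U.toScheme else V.toScheme
      f := fun t => match t with | true => a | false => b
      mem₀ := by
        rw [presieve₀_mem_precoverage_iff]
        refine ⟨fun z => ?_, ?_⟩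
        · obtain h | h := hab z
          · exact ⟨true, h⟩
          · exact ⟨false, h⟩
        · rintro (_ | _) <;> assumption }
  have hred : IsReduced Z := by
    have : ∀ t, IsReduced (𝒰.X t) := by
      rintro (_ | _)
      · exact inferInstanceAs (IsReduced V.toScheme)
      · exact inferInstanceAs (IsReduced U.toScheme)
    exact IsReduced.of_openCover _ 𝒰
  have hft : LocallyOfFiniteType s := by
    have : IsZariskiLocalAtSource @LocallyOfFiniteType :=
      HasRingHomProperty.instIsZariskiLocalAtSource
    rw [IsZariskiLocalAtSource.iff_of_openCover (P := @LocallyOfFiniteType) 𝒰]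
    rintro (_ | _)
    · exact hbs ▸ V.locallyOfFiniteType
    · exact has ▸ U.locallyOfFiniteType
  have hqc : QuasiCompact s := by
    rw [quasiCompact_iff_compactSpace, ← isCompact_univ_iff, ← hcov]
    have := U.isNoetherian
    have := V.isNoetherian
    exact (isCompact_range a.continuous).union (isCompact_range b.continuous)
  exact ⟨⟨Z, s, isIntegral_of_irreducibleSpace_of_isReduced Z, hsep, hft, hqc⟩, a, b, ha, hb,
    has, hbs, hij, hab⟩

end BirGeom

namespace BirGeom

open Scheme Limits

lemma exists_finite_subset_forall_mem_closure {T : Type*} [TopologicalSpace T]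
    [TopologicalSpace.NoetherianSpace T] [QuasiSober T] {C : Set T} (hC : IsClosed C) :
    ∃ S : Set T, S.Finite ∧ S ⊆ C ∧ ∀ x ∈ C, ∃ z ∈ S, z ⤳ x := by
  obtain ⟨S, hS, hS₁, hS₂, rfl⟩ :=
    TopologicalSpace.NoetherianSpace.exists_finite_set_isClosed_irreducible hC
  choose g hg using fun s : S => QuasiSober.sober (hS₂ s s.2) (hS₁ s s.2)
  have := hS.to_subtype
  refine ⟨Set.range g, Set.finite_range g, ?_, ?_⟩
  · rintro _ ⟨s, rfl⟩
    exact ⟨s, s.2, (hg s).mem⟩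
  · rintro x ⟨s, hs, hx⟩
    exact ⟨g ⟨s, hs⟩, ⟨_, rfl⟩, (hg ⟨s, hs⟩).specializes hx⟩

namespace BirationalMap

variable {k : Type u} [Field k] {X Y Z W : Variety k}

lemma ext_hom {f g : BirationalMap X Y} (h : f.hom = g.hom) : f = g := by
  refine BirationalMap.ext h ?_
  have h₁ : f.inv.comp (g.hom.comp g.inv) = f.inv := by
    rw [g.hom_inv, RationalMap.comp_id]
  have h₂ : f.inv.comp (f.hom.comp g.inv) = g.inv := by
    rw [← RationalMap.comp_assoc]
    simp only [f.inv_hom, RationalMap.id_comp]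
  refine h₁.symm.trans (Eq.trans ?_ h₂)
  simp only [h]

lemma eq_of_toRationalMap_comp_eq {U V W : Scheme.{u}} [IsIntegral U] [IsIntegral V]
    (w : U ⟶ V) [IsOpenImmersion w] [IsDominant w] {r s : V ⤏ W}
    [Nonempty W] (h : (Hom.toRationalMap w).comp r = (Hom.toRationalMap w).comp s) : r = s := by
  have key (t : V ⤏ W) :
      w.openImmersionInv.toRationalMap.comp ((Hom.toRationalMap w).comp t) = t := by
    rw [← RationalMap.comp_assoc]
    simp only [Hom.openImmersionInv_comp, RationalMap.id_comp]
  rw [← key r, h, key]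

/-- Two birational maps with a common chart agree. -/
lemma eq_trans_of_charts {f : BirationalMap X Y} {g : BirationalMap Y Z} {h : BirationalMap X Z}
    (c : f.Chart) (d : g.Chart) (e : h.Chart) (s : c.dom ⟶ d.dom) (t : c.dom ⟶ e.dom)
    (hs : s ≫ d.fst = c.snd) (ht : t ≫ e.fst = c.fst) (hst : s ≫ d.snd = t ≫ e.snd) :
    f.trans g = h := by
  have : IsOpenImmersion (s ≫ d.fst) := hs ▸ inferInstance
  have : IsOpenImmersion (t ≫ e.fst) := ht ▸ inferInstance
  have : IsOpenImmersion s := .of_comp _ d.fst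
  have : IsOpenImmersion t := .of_comp _ e.fst
  have : IsDominant (s ≫ d.fst) := hs ▸ inferInstance
  have : IsDominant (t ≫ e.fst) := ht ▸ inferInstance
  refine ext_hom (eq_of_toRationalMap_comp_eq c.fst ?_)
  change RationalMap.comp _ (f.hom.comp g.hom) = _
  rw [← RationalMap.comp_assoc]
  simp only [c.comp_hom]
  refine (toRationalMap_comp_congr hs.symm g.hom).trans (Eq.trans ?_
    (toRationalMap_comp_congr ht h.hom))
  have h₁ : (Hom.toRationalMap (s ≫ d.fst)).comp g.hom = Hom.toRationalMap (s ≫ d.snd) :=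
    (d.restrict s).comp_hom
  have h₂ : (Hom.toRationalMap (t ≫ e.fst)).comp h.hom = Hom.toRationalMap (t ≫ e.snd) :=
    (e.restrict t).comp_hom
  rw [h₁, h₂, hst]

lemma exists_open_of_finite {T : Type*} [TopologicalSpace T] {K F : Set T} (hF : F.Finite)
    (hK : ∀ x ∈ K, ∀ x', x' ⤳ x → x' ∈ K) (hKF : Disjoint K F) :
    ∃ U : TopologicalSpace.Opens T, K ⊆ U ∧ ∀ z ∈ F, ∀ x ∈ U, ¬ z ⤳ x := by
  refine ⟨⟨(⋃ z ∈ F, closure {z})ᶜ, (hF.isClosed_biUnion fun _ _ => isClosed_closure).isOpen_compl⟩,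
    ?_, ?_⟩
  · intro x hx h
    simp only [Set.mem_iUnion] at h
    obtain ⟨z, hz, hzx⟩ := h
    exact hKF.ne_of_mem (hK x hx z (specializes_iff_mem_closure.mpr hzx)) hz rfl
  · intro z hz x hx h
    refine hx ?_
    simp only [Set.mem_iUnion]
    exact ⟨z, hz, specializes_iff_mem_closure.mp h⟩

/-- Open subschemes of `X` and `Y` can be glued along `f : X ⇢ Y` to a variety containing given
sets `KX` and `KY` of points stable under generization and avoiding finitely many other points,
if no point of the graph closure lying over `KX` and `KY` obstructs this. -/
lemma exists_glue (f : BirationalMap X Y) (hf : f.excᶜ.Nonempty) {KX EX : Set X.toScheme}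
    {KY EY : Set Y.toScheme} (hX : KX.Nonempty) (hY : KY.Nonempty)
    (hKX : ∀ x ∈ KX, ∀ x', x' ⤳ x → x' ∈ KX) (hKY : ∀ y ∈ KY, ∀ y', y' ⤳ y → y' ∈ KY)
    (hEX : EX.Finite) (hEY : EY.Finite) (hKEX : Disjoint KX EX) (hKEY : Disjoint KY EY)
    (hbad : ∀ (c : f.Chart), ∀ z ∈ closure (Set.range c.graph),
      pullback.fst X.str Y.str z ∈ KX → pullback.snd X.str Y.str z ∈ KY →
        f.Rel (pullback.fst X.str Y.str z) (pullback.snd X.str Y.str z)) :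
    ∃ (Z : Variety k) (i : BirationalMap X Z) (j : BirationalMap Y Z), f.trans j = i ∧
      (∀ x ∈ KX, ∃ z, i.Rel x z) ∧ (∀ y ∈ KY, ∃ z, j.Rel y z) ∧
      ∀ z, (∃ x, x ∉ EX ∧ i.Rel x z) ∨ ∃ y, y ∉ EY ∧ j.Rel y z := by
  obtain ⟨c, hc⟩ := f.exists_chart_range_fst_eq hf
  have hclosed : IsClosed (closure (Set.range c.graph) ∩
      (pullback.fst X.str Y.str ⁻¹' (Set.range c.fst))ᶜ) :=
    isClosed_closure.inter
      ((c.fst.isOpenEmbedding.isOpen_range.preimage (Hom.continuous _)).isClosed_compl)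
  obtain ⟨S, hS, hSB, hSspec⟩ := exists_finite_subset_forall_mem_closure hclosed
  have hSK : ∀ z ∈ S, pullback.fst X.str Y.str z ∉ KX ∨ pullback.snd X.str Y.str z ∉ KY := by
    intro z hz
    by_contra! h
    refine (hSB hz).2 ?_
    rw [Set.mem_preimage, hc]
    exact (hbad c z (hSB hz).1 h.1 h.2).notMem_exc
  obtain ⟨(U : X.toScheme.Opens), hKU, hU⟩ := exists_open_of_finite
    (F := EX ∪ (pullback.fst X.str Y.str '' S \ KX)) (hEX.union (hS.image _).sdiff) hKX
    (Set.disjoint_union_right.mpr ⟨hKEX, Set.disjoint_sdiff_right⟩)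
  obtain ⟨(V : Y.toScheme.Opens), hKV, hV⟩ := exists_open_of_finite
    (F := EY ∪ (pullback.snd X.str Y.str '' S \ KY)) (hEY.union (hS.image _).sdiff) hKY
    (Set.disjoint_union_right.mpr ⟨hKEY, Set.disjoint_sdiff_right⟩)
  have : Nonempty U := (hX.mono hKU).to_subtype
  have : Nonempty V := (hY.mono hKV).to_subtype
  let D : c.dom.Opens := c.fst ⁻¹ᵁ U ⊓ c.snd ⁻¹ᵁ V
  have hD : Nonempty D := by
    obtain ⟨_, hx, d, rfl⟩ :=
      c.fst.denseRange.inter_open_nonempty _ U.isOpen (hX.mono hKU)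
    obtain ⟨_, hy, d', rfl⟩ :=
      c.snd.denseRange.inter_open_nonempty _ V.isOpen (hY.mono hKV)
    exact (nonempty_preirreducible_inter (c.fst ⁻¹ᵁ U).isOpen (c.snd ⁻¹ᵁ V).isOpen
      ⟨d, hx⟩ ⟨d', hy⟩).to_subtype
  let i : D.toScheme ⟶ U.toScheme := IsOpenImmersion.lift U.ι (D.ι ≫ c.fst) (by
    rintro _ ⟨d, rfl⟩
    rw [Opens.range_ι]
    exact d.2.1)
  let j : D.toScheme ⟶ V.toScheme := IsOpenImmersion.lift V.ι (D.ι ≫ c.snd) (by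
    rintro _ ⟨d, rfl⟩
    rw [Opens.range_ι]
    exact d.2.2)
  have hi : i ≫ U.ι = D.ι ≫ c.fst := IsOpenImmersion.lift_fac _ _ _
  have hj : j ≫ V.ι = D.ι ≫ c.snd := IsOpenImmersion.lift_fac _ _ _
  have : IsOpenImmersion (i ≫ U.ι) := hi ▸ inferInstance
  have : IsOpenImmersion (j ≫ V.ι) := hj ▸ inferInstance
  have : IsOpenImmersion i := .of_comp _ U.ι
  have : IsOpenImmersion j := .of_comp _ V.ι
  have hij : i ≫ U.ι ≫ X.str = j ≫ V.ι ≫ Y.str := by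
    rw [← Category.assoc, hi, ← Category.assoc, hj, Category.assoc, c.fst_str, Category.assoc]
  have hrange : IsClosed (Set.range (pullback.lift i j hij)) := by
    let m := pullback.map (U.ι ≫ X.str) (V.ι ≫ Y.str) X.str Y.str U.ι V.ι (𝟙 _) (by simp) (by simp)
    let l : D.toScheme ⟶ pullback (U.ι ≫ X.str) (V.ι ≫ Y.str) := pullback.lift i j hij
    have hm : m ≫ pullback.fst X.str Y.str = pullback.fst _ _ ≫ U.ι := pullback.lift_fst _ _ _
    have hm' : m ≫ pullback.snd X.str Y.str = pullback.snd _ _ ≫ V.ι := pullback.lift_snd _ _ _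
    have hlf : l ≫ pullback.fst _ _ = i := pullback.lift_fst _ _ _
    have hls : l ≫ pullback.snd _ _ = j := pullback.lift_snd _ _ _
    have hl : l ≫ m = D.ι ≫ c.graph := by
      apply pullback.hom_ext
      · rw [Category.assoc, hm, ← Category.assoc, hlf, hi, Category.assoc, c.graph_fst]
      · rw [Category.assoc, hm', ← Category.assoc, hls, hj, Category.assoc, c.graph_snd]
    have e : Set.range l = m ⁻¹' closure (Set.range c.graph) := by
      ext p
      constructor
      · rintro ⟨d, rfl⟩
        refine subset_closure ⟨D.ι d, ?_⟩
        rw [← Hom.comp_apply, ← Hom.comp_apply, hl]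
      · intro hp
        have hpU : pullback.fst X.str Y.str (m p) ∈ U := by
          rw [← Hom.comp_apply, hm, Hom.comp_apply]
          exact (pullback.fst (U.ι ≫ X.str) (V.ι ≫ Y.str) p).2
        have hpV : pullback.snd X.str Y.str (m p) ∈ V := by
          rw [← Hom.comp_apply, hm', Hom.comp_apply]
          exact (pullback.snd (U.ι ≫ X.str) (V.ι ≫ Y.str) p).2
        have hpc : pullback.fst X.str Y.str (m p) ∈ Set.range c.fst := by
          by_contra h
          obtain ⟨z, hz, hzp⟩ := hSspec (m p) ⟨hp, h⟩
          obtain h | h := hSK z hz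
          · exact hU _ (Or.inr ⟨⟨z, hz, rfl⟩, h⟩) _ hpU (hzp.map (Hom.continuous _))
          · exact hV _ (Or.inr ⟨⟨z, hz, rfl⟩, h⟩) _ hpV (hzp.map (Hom.continuous _))
        obtain ⟨d, hd⟩ := c.mem_range_graph_of_fst hp hpc
        have hdU : c.fst d ∈ U := by
          rwa [← c.graph_fst, Hom.comp_apply, hd]
        have hdV : c.snd d ∈ V := by
          rwa [← c.graph_snd, Hom.comp_apply, hd]
        obtain ⟨d, rfl⟩ : ∃ d' : D.toScheme, D.ι d' = d := ⟨⟨d, hdU, hdV⟩, rfl⟩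
        refine ⟨d, m.isOpenEmbedding.injective ?_⟩
        rw [← Hom.comp_apply, hl, Hom.comp_apply, ← hd]
    change IsClosed (Set.range l)
    rw [e]
    exact isClosed_closure.preimage m.continuous
  let i' : D.toScheme ⟶ (X.ofOpen U).toScheme := i
  let j' : D.toScheme ⟶ (Y.ofOpen V).toScheme := j
  have : IsOpenImmersion i' := ‹IsOpenImmersion i›
  have : IsOpenImmersion j' := ‹IsOpenImmersion j›
  obtain ⟨Z, a, b, ha, hb, ha', hb', hab, hZ⟩ :=
    Variety.exists_glue (X.ofOpen U) (Y.ofOpen V) i' j' hij hrange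
  let α : U.toScheme ⟶ Z.toScheme := a
  let β : V.toScheme ⟶ Z.toScheme := b
  have : IsOpenImmersion α := ha
  have : IsOpenImmersion β := hb
  let I : BirationalMap X Z := ofSpan U.ι α ha'.symm
  let J : BirationalMap Y Z := ofSpan V.ι β hb'.symm
  refine ⟨Z, I, J, ?_, ?_, ?_, ?_⟩
  · exact eq_trans_of_charts (c.restrict D.ι) (ofSpanChart V.ι β hb'.symm)
      (ofSpanChart U.ι α ha'.symm) j i hj hi hab.symm
  · intro x hx
    exact ⟨α ⟨x, hKU hx⟩, ofSpanChart U.ι α ha'.symm, ⟨x, hKU hx⟩, rfl, rfl⟩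
  · intro y hy
    exact ⟨β ⟨y, hKV hy⟩, ofSpanChart V.ι β hb'.symm, ⟨y, hKV hy⟩, rfl, rfl⟩
  · intro z
    obtain ⟨u, rfl⟩ | ⟨v, rfl⟩ := hZ z
    · exact Or.inl ⟨U.ι u, fun h => hU _ (Or.inl h) _ u.2 specializes_rfl,
        ofSpanChart U.ι α ha'.symm, u, rfl, rfl⟩
    · exact Or.inr ⟨V.ι v, fun h => hV _ (Or.inl h) _ v.2 specializes_rfl,
        ofSpanChart V.ι β hb'.symm, v, rfl, rfl⟩

end BirationalMap

end BirGeom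

namespace BirGeom

/-- The circumcentre of a bounded set `K` relative to a closed convex set `C` of a Hilbert space:
it is fixed by every isometry that preserves `K` and `C`. -/
lemma exists_circumcenter {H : Type*} [NormedAddCommGroup H] [InnerProductSpace ℝ H]
    [CompleteSpace H] {K C : Set H} (hK : K.Nonempty) {M : ℝ}
    (hM : ∀ x ∈ K, ‖x‖ ≤ M) (h0 : (0 : H) ∈ C) (hC : IsClosed C) (hconv : Convex ℝ C) :
    ∃ c ∈ C, ∀ T : H → H, Isometry T → (∀ x ∈ K, ∃ x' ∈ K, T x' = x) → Set.MapsTo T C C →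
      T c = c := by
  obtain ⟨x₀, hx₀⟩ := hK
  let P : Set ℝ := {ρ | 0 ≤ ρ ∧ ∃ y ∈ C, ∀ x ∈ K, ‖x - y‖ ≤ ρ}
  have hP : P.Nonempty :=
    ⟨M, (norm_nonneg _).trans (hM x₀ hx₀), 0, h0, fun x hx => by simpa using hM x hx⟩
  have hP' : BddBelow P := ⟨0, fun ρ hρ => hρ.1⟩
  let R := sInf P
  have hR : 0 ≤ R := le_csInf hP fun ρ hρ => hρ.1
  have key (ρ : ℝ) (y y' : H) (hy : y ∈ C) (hy' : y' ∈ C) (h : ∀ x ∈ K, ‖x - y‖ ≤ ρ)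
      (h' : ∀ x ∈ K, ‖x - y'‖ ≤ ρ) : ‖y - y'‖ ^ 2 ≤ 4 * (ρ ^ 2 - R ^ 2) := by
    let m : H := (1 / 2 : ℝ) • y + (1 / 2 : ℝ) • y'
    have hm : m ∈ C := hconv hy hy' (by norm_num) (by norm_num) (by norm_num)
    have hx (x : H) (hx : x ∈ K) : ‖x - m‖ ^ 2 ≤ ρ ^ 2 - ‖y - y'‖ ^ 2 / 4 := by
      have e := parallelogram_law_with_norm ℝ (x - y) (x - y')
      have e₁ : x - y + (x - y') = (2 : ℝ) • (x - m) := by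
        simp only [m]
        module
      have e₂ : x - y - (x - y') = -(y - y') := by abel
      rw [e₁, e₂, norm_neg, norm_smul, Real.norm_ofNat] at e
      have h₁ := pow_le_pow_left₀ (norm_nonneg _) (h x hx) 2
      have h₂ := pow_le_pow_left₀ (norm_nonneg _) (h' x hx) 2
      nlinarith
    have hnn : 0 ≤ ρ ^ 2 - ‖y - y'‖ ^ 2 / 4 := (sq_nonneg _).trans (hx x₀ hx₀)
    have hmem : Real.sqrt (ρ ^ 2 - ‖y - y'‖ ^ 2 / 4) ∈ P :=
      ⟨Real.sqrt_nonneg _, m, hm, fun x hxK => Real.le_sqrt_of_sq_le (hx x hxK)⟩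
    have h₃ := pow_le_pow_left₀ hR (csInf_le hP' hmem) 2
    rw [Real.sq_sqrt hnn] at h₃
    linarith
  have hex (n : ℕ) : ∃ y ∈ C, ∀ x ∈ K, ‖x - y‖ ≤ R + 1 / (n + 1) := by
    obtain ⟨ρ, hρ, hlt⟩ := exists_lt_of_csInf_lt hP
      (show R < R + 1 / ((n : ℝ) + 1) by linarith [Nat.one_div_pos_of_nat (α := ℝ) (n := n)])
    obtain ⟨y, hy, h⟩ := hρ.2
    exact ⟨y, hy, fun x hx => (h x hx).trans hlt.le⟩
  choose y hyC hy using hex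
  have hlim : Filter.Tendsto (fun n : ℕ => R + 1 / ((n : ℝ) + 1)) Filter.atTop (nhds R) := by
    simpa using tendsto_one_div_add_atTop_nhds_zero_nat.const_add R
  have hcau : CauchySeq y := by
    refine cauchySeq_of_le_tendsto_0
      (fun n => Real.sqrt (4 * ((R + 1 / ((n : ℝ) + 1)) ^ 2 - R ^ 2))) ?_ ?_
    · intro n m N hn hm
      rw [dist_eq_norm]
      have hmono (n : ℕ) (hn : N ≤ n) : R + 1 / ((n : ℝ) + 1) ≤ R + 1 / ((N : ℝ) + 1) := by
        have := Nat.one_div_le_one_div (α := ℝ) hn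
        linarith
      exact Real.le_sqrt_of_sq_le (key _ _ _ (hyC n) (hyC m)
        (fun x hx => (hy n x hx).trans (hmono n hn)) fun x hx => (hy m x hx).trans (hmono m hm))
    · have := ((((hlim.pow 2).sub_const (R ^ 2)).const_mul 4)).sqrt
      simpa using this
  obtain ⟨c, hc⟩ := cauchySeq_tendsto_of_complete hcau
  have hcC : c ∈ C := hC.mem_of_tendsto hc (Filter.Eventually.of_forall hyC)
  have hcR (x : H) (hx : x ∈ K) : ‖x - c‖ ≤ R :=
    le_of_tendsto_of_tendsto' (hc.const_sub x).norm hlim fun n => hy n x hx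
  refine ⟨c, hcC, fun T hT hTK hTC => ?_⟩
  have h := key R (T c) c (hTC hcC) hcC (fun x hx => ?_) hcR
  · have : ‖T c - c‖ = 0 := by
      rw [sub_self, mul_zero] at h
      exact pow_eq_zero_iff (two_ne_zero) |>.mp (le_antisymm h (sq_nonneg _))
    exact sub_eq_zero.mp (norm_eq_zero.mp this)
  · obtain ⟨x', hx', rfl⟩ := hTK x hx
    rw [← dist_eq_norm, hT.dist_eq, dist_eq_norm]
    exact hcR x' hx'

open scoped lp ENNReal

lemma lp_two_norm_sq {S : Type*} (v : ℓ²(S, ℝ)) : ‖v‖ ^ 2 = ∑' s, (v s) ^ 2 := by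
  have := lp.norm_rpow_eq_tsum (p := 2) (by norm_num) v
  simpa using this

lemma lp_two_summable_sq {S : Type*} (v : ℓ²(S, ℝ)) : Summable fun s => (v s) ^ 2 := by
  have := (lp.memℓp v).summable (by norm_num)
  simpa using this

lemma memlp_two_of_summable {S : Type*} {v : S → ℝ} (h : Summable fun s => (v s) ^ 2) :
    Memℓp (E := fun _ : S => ℝ) v 2 := by
  apply memℓp_gen
  simpa using h

/-- If the translates of `A` differ from `A` by a bounded number of elements, then `A` differs by
finitely many elements from an invariant set `B`, of which any two elements lie in a common
translate of `A`. -/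
theorem exists_invariant_commensurate {G S : Type*} [Group G] [MulAction G S] (A : Set S) (N : ℕ)
    (h : ∀ g : G, {s | g⁻¹ • s ∈ A ∧ s ∉ A}.encard ≤ N) :
    ∃ B : Set S, (∀ (g : G), ∀ s ∈ B, g • s ∈ B) ∧ (A \ B).Finite ∧ (B \ A).Finite ∧
      ∀ a ∈ B, ∀ b ∈ B, ∃ g : G, g⁻¹ • a ∈ A ∧ g⁻¹ • b ∈ A := by
  classical
  let χ : S → ℝ := fun s => if s ∈ A then 1 else 0
  let D (g : G) : Set S := {s | g⁻¹ • s ∈ A ∧ s ∉ A} ∪ {s | s ∈ A ∧ g⁻¹ • s ∉ A}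
  have hD (g : G) : (D g).encard ≤ (2 * N : ℕ) := by
    have e : {s | s ∈ A ∧ g⁻¹ • s ∉ A} = (fun s => g • s) '' {s | (g⁻¹)⁻¹ • s ∈ A ∧ s ∉ A} := by
      ext s
      simp only [Set.mem_ofPred_eq, inv_inv, Set.mem_image]
      constructor
      · rintro ⟨h₁, h₂⟩
        exact ⟨g⁻¹ • s, ⟨by rwa [smul_inv_smul], h₂⟩, smul_inv_smul _ _⟩
      · rintro ⟨s, ⟨h₁, h₂⟩, rfl⟩
        exact ⟨h₁, by rwa [inv_smul_smul]⟩
    refine (Set.encard_union_le _ _).trans ?_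
    rw [e, two_mul, Nat.cast_add]
    exact add_le_add (h g) ((Set.encard_image_le _ _).trans (h g⁻¹))
  have hDfin (g : G) : (D g).Finite := Set.finite_of_encard_le_coe (hD g)
  have hsupp (g : G) (s : S) (hs : s ∉ D g) : χ (g⁻¹ • s) - χ s = 0 := by
    by_cases h₁ : g⁻¹ • s ∈ A <;> by_cases h₂ : s ∈ A <;> simp [D, χ, h₁, h₂] at hs ⊢
  have hone (g : G) (s : S) : (χ (g⁻¹ • s) - χ s) ^ 2 ≤ 1 := by
    by_cases h₁ : g⁻¹ • s ∈ A <;> by_cases h₂ : s ∈ A <;> simp [χ, h₁, h₂]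
  have hsum (g : G) : Summable fun s => (χ (g⁻¹ • s) - χ s) ^ 2 :=
    summable_of_ne_finset_zero (s := (hDfin g).toFinset) fun s hs => by
      rw [hsupp g s (by simpa using hs), zero_pow two_ne_zero]
  let b (g : G) : ℓ²(S, ℝ) := ⟨fun s => χ (g⁻¹ • s) - χ s, memlp_two_of_summable (hsum g)⟩
  have hb (g : G) (s : S) : b g s = χ (g⁻¹ • s) - χ s := rfl
  have hbnorm (g : G) : ‖b g‖ ≤ Real.sqrt (2 * N : ℕ) := by
    apply Real.le_sqrt_of_sq_le
    rw [lp_two_norm_sq]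
    simp only [hb]
    rw [tsum_eq_sum (s := (hDfin g).toFinset) fun s hs => by
      rw [hsupp g s (by simpa using hs), zero_pow two_ne_zero]]
    refine (Finset.sum_le_card_nsmul _ _ 1 fun s _ => hone g s).trans ?_
    have hcard : ((hDfin g).toFinset.card : ℕ∞) ≤ (2 * N : ℕ) := by
      rw [← Set.encard_coe_eq_coe_finsetCard]
      simpa using hD g
    rw [nsmul_eq_mul, mul_one]
    exact_mod_cast hcard
  have hTsum (g : G) (v : ℓ²(S, ℝ)) : Memℓp (E := fun _ : S => ℝ) (fun s => v (g⁻¹ • s)) 2 :=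
    memlp_two_of_summable
      ((lp_two_summable_sq v).comp_injective (MulAction.injective g⁻¹))
  let ρ (g : G) (v : ℓ²(S, ℝ)) : ℓ²(S, ℝ) := ⟨fun s => v (g⁻¹ • s), hTsum g v⟩
  have hρ (g : G) (v : ℓ²(S, ℝ)) (s : S) : ρ g v s = v (g⁻¹ • s) := rfl
  let T (g : G) (v : ℓ²(S, ℝ)) : ℓ²(S, ℝ) := ρ g v + b g
  have hTapp (g : G) (v : ℓ²(S, ℝ)) (s : S) : T g v s = v (g⁻¹ • s) + (χ (g⁻¹ • s) - χ s) := rfl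
  have hTiso (g : G) : Isometry (T g) := by
    refine Isometry.of_dist_eq fun v w => ?_
    rw [dist_eq_norm, dist_eq_norm]
    have e : T g v - T g w = ρ g (v - w) := by
      ext s
      simp only [lp.coeFn_sub, Pi.sub_apply, hTapp, hρ]
      ring
    rw [e, ← sq_eq_sq₀ (norm_nonneg _) (norm_nonneg _), lp_two_norm_sq, lp_two_norm_sq]
    simp only [hρ]
    exact (MulAction.toPerm g⁻¹).tsum_eq fun s => ((v - w) s) ^ 2
  have hTb (g g' : G) : T g (b g') = b (g * g') := by
    ext s
    rw [hTapp, hb, hb, mul_inv_rev, mul_smul]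
    ring
  let K : Set (ℓ²(S, ℝ)) := Set.range b
  let C : Set (ℓ²(S, ℝ)) := closure (convexHull ℝ K)
  have hC : Convex ℝ C := (convex_convexHull ℝ K).closure
  have hKC : K ⊆ C := (subset_convexHull ℝ K).trans subset_closure
  have hCmin {E : Set (ℓ²(S, ℝ))} (hE : Convex ℝ E) (hE' : IsClosed E) (hKE : K ⊆ E) : C ⊆ E :=
    closure_minimal (convexHull_min hKE hE) hE'
  have hb1 : b 1 = 0 := by
    ext s
    rw [hb, inv_one, one_smul, sub_self]
    rfl
  obtain ⟨c, hcC, hc⟩ := exists_circumcenter (K := K) (C := C) ⟨_, 1, rfl⟩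
    (M := Real.sqrt (2 * N : ℕ)) (by rintro _ ⟨g, rfl⟩; exact hbnorm g)
    (hKC ⟨1, hb1⟩) isClosed_closure hC
  have hTc (g : G) : T g c = c := by
    refine hc (T g) (hTiso g) ?_ ?_
    · rintro _ ⟨g', rfl⟩
      exact ⟨b (g⁻¹ * g'), ⟨_, rfl⟩, by rw [hTb, mul_inv_cancel_left]⟩
    · refine hCmin (E := T g ⁻¹' C) ?_ (isClosed_closure.preimage (hTiso g).continuous) ?_
      · intro v hv w hw x y hx hy hxy
        have e : T g (x • v + y • w) = x • T g v + y • T g w := by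
          ext s
          simp only [lp.coeFn_add, lp.coeFn_smul, Pi.add_apply, Pi.smul_apply, hTapp, smul_eq_mul]
          linear_combination (χ s - χ (g⁻¹ • s)) * hxy
        rw [Set.mem_preimage, e]
        exact hC hv hw hx hy hxy
      · rintro _ ⟨g', rfl⟩
        rw [Set.mem_preimage, hTb]
        exact hKC ⟨_, rfl⟩
  have hinv (g : G) (s : S) : χ (g • s) + c (g • s) = χ s + c s := by
    have := congrArg (fun v : ℓ²(S, ℝ) => v (g • s)) (hTc g)
    simp only [hTapp, inv_smul_smul] at this
    linarith
  have hfin : {s | (1 / 4 : ℝ) ≤ (c s) ^ 2}.Finite := by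
    have := (lp_two_summable_sq c).tendsto_cofinite_zero.eventually
      (gt_mem_nhds (show (0 : ℝ) < 1 / 4 by norm_num))
    rw [Filter.eventually_cofinite] at this
    simpa using this
  have happ (s : S) : Continuous fun v : ℓ²(S, ℝ) => v s :=
    (continuous_apply s).comp (lp.uniformContinuous_coe (p := 2)).continuous
  refine ⟨{s | 1 / 2 < χ s + c s}, ?_, ?_, ?_, ?_⟩
  · intro g s hs
    rwa [Set.mem_ofPred_eq, hinv]
  · refine hfin.subset ?_
    rintro s ⟨hs, hs'⟩
    simp only [Set.mem_ofPred_eq, χ, if_pos hs, not_lt] at hs' ⊢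
    nlinarith
  · refine hfin.subset ?_
    rintro s ⟨hs, hs'⟩
    simp only [Set.mem_ofPred_eq, χ, if_neg hs'] at hs ⊢
    nlinarith
  · intro x hx y hy
    by_contra! hxy
    have hsub : C ⊆ {v : ℓ²(S, ℝ) | v x + v y ≤ 1 - χ x - χ y} := by
      refine hCmin ?_ (isClosed_le ((happ x).add (happ y)) continuous_const) ?_
      · exact convex_halfSpace_le
          (f := fun v : ℓ²(S, ℝ) => v x + v y)
          ⟨fun v w => by simp only [lp.coeFn_add, Pi.add_apply]; ring,
            fun r v => by simp only [lp.coeFn_smul, Pi.smul_apply, smul_eq_mul]; ring⟩ _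
      · rintro _ ⟨g, rfl⟩
        simp only [Set.mem_ofPred_eq, hb]
        have : χ (g⁻¹ • x) + χ (g⁻¹ • y) ≤ 1 := by
          by_cases h₁ : g⁻¹ • x ∈ A
          · simp [χ, h₁, hxy g h₁]
          · simp only [χ, h₁, if_false]
            split_ifs <;> norm_num
        linarith
    have := hsub hcC
    simp only [Set.mem_ofPred_eq] at this hx hy
    linarith

end BirGeom

namespace BirGeom

lemma encard_le_of_rel {α β : Type*} {R : α → β → Prop} {T : Set α} {E : Set β}
    (h : ∀ x ∈ T, ∃ y ∈ E, R x y) (hR : ∀ x x' y, R x y → R x' y → x = x') :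
    T.encard ≤ E.encard := by
  obtain rfl | ⟨x₀, hx₀⟩ := T.eq_empty_or_nonempty
  · simp
  have : Nonempty β := ⟨(h x₀ hx₀).choose⟩
  choose! p hp hp' using h
  exact Set.encard_le_encard_of_injOn hp fun x hx x' hx' e =>
    hR x x' (p x) (hp' x hx) (e ▸ hp' x' hx')

variable {k : Type u} [Field k] {X Y Z : Variety k}

lemma coheight_irreducibleSetEquivPoints
    (W : TopologicalSpace.IrreducibleCloseds X.toScheme) :
    Order.coheight (irreducibleSetEquivPoints W) = Order.coheight W :=
  Order.coheight_orderIso _ _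

lemma coheight_add_one_le_of_specializes {x x' : X.toScheme} (h : x' ⤳ x) (hne : x' ≠ x) :
    Order.coheight x' + 1 ≤ Order.coheight x :=
  Order.coheight_add_one_le (lt_of_le_not_ge h fun h' => hne (Specializes.antisymm h h').eq)

lemma coheight_genericPoint : Order.coheight (genericPoint X.toScheme) = 0 :=
  Order.coheight_eq_zero.mpr fun x _ => genericPoint_specializes x

lemma subset_iff_irreducibleSetEquivPoints_mem {C : Set X.toScheme} (hC : IsClosed C)
    (W : TopologicalSpace.IrreducibleCloseds X.toScheme) :
    (W : Set X.toScheme) ⊆ C ↔ irreducibleSetEquivPoints W ∈ C := by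
  obtain ⟨x, rfl⟩ := irreducibleSetEquivPoints.symm.surjective W
  rw [OrderIso.apply_symm_apply]
  exact ⟨fun h => h (subset_closure rfl),
    fun h => closure_minimal (Set.singleton_subset_iff.mpr h) hC⟩

lemma lt_codim_iff {C : Set X.toScheme} (hC : IsClosed C) {l : ℕ} :
    (l : ℕ∞) < codim C ↔ ∀ x ∈ C, (l : ℕ∞) < Order.coheight x := by
  simp only [← ENat.add_one_le_iff (ENat.natCast_ne_top l), codim, le_iInf_iff,
    subset_iff_irreducibleSetEquivPoints_mem hC, ← coheight_irreducibleSetEquivPoints]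
  exact (irreducibleSetEquivPoints (α := X.toScheme)).surjective.forall
    (p := fun x => x ∈ C → (l : ℕ∞) + 1 ≤ Order.coheight x) |>.symm

namespace BirationalMap

variable {l : ℕ}

lemma isIsoInCodim_iff {f : BirationalMap X Y} :
    f.IsIsoInCodim l ↔ (∀ x, Order.coheight x ≤ (l : ℕ∞) → ∃ y, f.Rel x y) ∧
      ∀ y, Order.coheight y ≤ (l : ℕ∞) → ∃ x, f.symm.Rel y x := by
  simp only [IsIsoInCodim, lt_codim_iff f.isClosed_exc, lt_codim_iff f.symm.isClosed_exc,
    ← notMem_exc_iff]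
  simp only [← not_lt]
  exact and_congr (forall_congr' fun _ => not_imp_not.symm)
    (forall_congr' fun _ => not_imp_not.symm)

lemma IsIsoInCodim.symm {f : BirationalMap X Y} (h : f.IsIsoInCodim l) : f.symm.IsIsoInCodim l :=
  ⟨h.2, h.1⟩

lemma IsIsoInCodim.trans {f : BirationalMap X Y} {g : BirationalMap Y Z} (hf : f.IsIsoInCodim l)
    (hg : g.IsIsoInCodim l) : (f.trans g).IsIsoInCodim l := by
  rw [isIsoInCodim_iff] at *
  constructor
  · intro x hx
    obtain ⟨y, hy⟩ := hf.1 x hx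
    obtain ⟨z, hz⟩ := hg.1 y (hy.coheight_eq ▸ hx)
    exact ⟨z, hy.trans hz⟩
  · intro z hz
    obtain ⟨y, hy⟩ := hg.2 z hz
    obtain ⟨x, hx⟩ := hf.2 y (hy.coheight_eq ▸ hz)
    exact ⟨x, hy.trans hx⟩

lemma isIsoInCodim_refl : (refl X).IsIsoInCodim l :=
  isIsoInCodim_iff.mpr ⟨fun x _ => ⟨x, rel_refl x⟩, fun x _ => ⟨x, rel_refl x⟩⟩

/-- The generic points of the components of codimension `m` of the exceptional locus of a map that
is an isomorphism in codimension `m - 1`. -/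
def excPoints (m : ℕ) (f : BirationalMap X Y) : Set X.toScheme :=
  {x | x ∈ f.exc ∧ Order.coheight x = (m : ℕ∞)}

lemma IsIsoInCodim.lt_coheight {f : BirationalMap X Y} (hf : f.IsIsoInCodim l) {x : X.toScheme}
    (hx : x ∈ f.exc) : (l : ℕ∞) < Order.coheight x :=
  (lt_codim_iff f.isClosed_exc).mp hf.1 x hx

lemma IsIsoInCodim.eq_of_specializes {f : BirationalMap X Y} (hf : f.IsIsoInCodim l)
    {x x' : X.toScheme} (hx : x ∈ f.excPoints (l + 1)) (hx' : x' ∈ f.exc) (h : x' ⤳ x) :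
    x' = x := by
  by_contra hne
  have h₁ := coheight_add_one_le_of_specializes h hne
  have h₂ := Order.add_one_le_of_lt (hf.lt_coheight hx')
  rw [hx.2] at h₁
  have h₃ : ((l + 1 + 1 : ℕ) : ℕ∞) ≤ ((l + 1 : ℕ) : ℕ∞) := by
    refine le_trans ?_ h₁
    push_cast
    gcongr
  exact absurd (ENat.natCast_le_natCast.mp h₃) (by omega)

lemma IsIsoInCodim.finite_excPoints {f : BirationalMap X Y} (hf : f.IsIsoInCodim l) :
    (f.excPoints (l + 1)).Finite := by
  obtain ⟨S, hS, hSC, h⟩ := exists_finite_subset_forall_mem_closure f.isClosed_exc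
  refine hS.subset fun x hx => ?_
  obtain ⟨z, hz, hzx⟩ := h x hx.1
  rwa [← hf.eq_of_specializes hx (hSC hz) hzx]

lemma IsIsoInCodim.encard_excComponents {f : BirationalMap X Y} (hf : f.IsIsoInCodim l) :
    (f.excComponents (l + 1)).encard = (f.excPoints (l + 1)).encard := by
  rw [← irreducibleSetEquivPoints.injective.encard_image (f.excComponents (l + 1))]
  congr 1
  ext x
  obtain ⟨W, rfl⟩ := irreducibleSetEquivPoints.surjective x
  rw [irreducibleSetEquivPoints.injective.mem_set_image]
  constructor
  · intro h
    exact ⟨(subset_iff_irreducibleSetEquivPoints_mem f.isClosed_exc W).mp h.1.1,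
      (coheight_irreducibleSetEquivPoints W).trans h.2⟩
  · intro h
    refine ⟨⟨(subset_iff_irreducibleSetEquivPoints_mem f.isClosed_exc W).mpr h.1,
      fun W' hW' hle => ?_⟩, (coheight_irreducibleSetEquivPoints W).symm.trans h.2⟩
    have := hf.eq_of_specializes h
      ((subset_iff_irreducibleSetEquivPoints_mem f.isClosed_exc W').mp hW')
      (irreducibleSetEquivPoints.monotone hle)
    exact (irreducibleSetEquivPoints.injective this).le

lemma Rel.injective {f : BirationalMap X Y} {x x' : X.toScheme} {y : Y.toScheme} (h : f.Rel x y)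
    (h' : f.Rel x' y) : x = x' :=
  h.symm.unique h'.symm

lemma trans_conj (f : BirationalMap X Y) (g : Bir X) : f.trans (f.conj g) = g.trans f := by
  rw [conj, ← trans_assoc, self_trans_symm, refl_trans]

lemma encard_excPoints_le {f : BirationalMap X Y} {g : Bir X} {m : ℕ}
    (h : (f.conj g).IsIsoInCodim m) :
    (g.excPoints m).encard ≤ (f.excPoints m).encard + (f.symm.excPoints m).encard := by
  have hsub : g.excPoints m ⊆ f.excPoints m ∪ g.excPoints m \ f.excPoints m := by
    rw [Set.union_sdiff_self]
    exact Set.subset_union_right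
  refine (Set.encard_le_encard hsub).trans ((Set.encard_union_le _ _).trans ?_)
  gcongr
  refine encard_le_of_rel (R := (g.trans f).Rel) ?_ fun _ _ _ h h' => h.injective h'
  rintro x ⟨⟨hx, hxm⟩, hx'⟩
  obtain ⟨y, hy⟩ := notMem_exc_iff.mp fun h' => hx' ⟨h', hxm⟩
  have hym := hy.coheight_eq ▸ hxm
  obtain ⟨y', hy'⟩ := (isIsoInCodim_iff.mp h).1 y hym.le
  have hr : (g.trans f).Rel x y' := trans_conj f g ▸ hy.trans hy'
  refine ⟨y', ⟨by_contra fun h' => ?_, hr.coheight_eq ▸ hxm⟩, hr⟩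
  obtain ⟨x', hx''⟩ := notMem_exc_iff.mp h'
  have := hr.trans hx''
  rw [trans_assoc, self_trans_symm, trans_refl] at this
  exact this.notMem_exc hx

end BirationalMap

open BirationalMap

/-- Two elements `(g, x)` and `(g', x')` of `G × X` are equivalent if `g'⁻¹ g` is a local
isomorphism at `x` mapping `x` to `x'`. -/
def translateSetoid (G : Subgroup (Bir X)) : Setoid (G × X.toScheme) where
  r p q := ((q.1 : Bir X)⁻¹ * p.1).Rel p.2 q.2
  iseqv.refl p := by
    rw [inv_mul_cancel]
    exact rel_refl p.2
  iseqv.symm {p q} h := by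
    have : ((q.1 : Bir X)⁻¹ * p.1)⁻¹.Rel q.2 p.2 := h.symm
    rwa [mul_inv_rev, inv_inv] at this
  iseqv.trans {p q r} h h' := by
    have : (((r.1 : Bir X)⁻¹ * q.1) * ((q.1 : Bir X)⁻¹ * p.1)).Rel p.2 r.2 := h.trans h'
    rwa [mul_assoc, mul_inv_cancel_left] at this

/-- The set of points of all translates of `X` by the elements of `G`, where points are identified
if they correspond to each other under a local isomorphism induced by the identity of `X`. -/
def TranslatePoint (G : Subgroup (Bir X)) : Type u :=
  Quotient (translateSetoid G)

namespace TranslatePoint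

variable {G : Subgroup (Bir X)} {l : ℕ}

/-- The point `x` of the translate of `X` by `g`. -/
def mk (g : G) (x : X.toScheme) : TranslatePoint G :=
  Quotient.mk (translateSetoid G) (g, x)

lemma mk_eq_mk_iff {g g' : G} {x x' : X.toScheme} :
    mk g x = mk g' x' ↔ ((g' : Bir X)⁻¹ * g).Rel x x' :=
  Quotient.eq (r := translateSetoid G)

lemma mk_surjective (s : TranslatePoint G) : ∃ g x, s = mk g x := by
  obtain ⟨⟨g, x⟩, rfl⟩ := Quotient.exists_rep s
  exact ⟨g, x, rfl⟩

noncomputable instance : MulAction G (TranslatePoint G) where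
  smul h := Quotient.map (fun p => (h * p.1, p.2)) fun p q hpq => by
    have e : ((h * q.1 : G) : Bir X)⁻¹ * (h * p.1 : G) = (q.1 : Bir X)⁻¹ * p.1 := by
      push_cast
      group
    change (((h * q.1 : G) : Bir X)⁻¹ * (h * p.1 : G)).Rel p.2 q.2
    rw [e]
    exact hpq
  one_smul s := by
    obtain ⟨g, x, rfl⟩ := mk_surjective s
    exact congrArg (mk · x) (one_mul g)
  mul_smul a b s := by
    obtain ⟨g, x, rfl⟩ := mk_surjective s
    exact congrArg (mk · x) (mul_assoc a b g)

@[simp]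
lemma smul_mk (h g : G) (x : X.toScheme) : h • mk g x = mk (h * g) x :=
  rfl

/-- The points of codimension `m` of `X` itself. -/
def base (G : Subgroup (Bir X)) (m : ℕ) : Set (TranslatePoint G) :=
  {s | ∃ x, Order.coheight x = (m : ℕ∞) ∧ s = mk 1 x}

lemma exists_of_inv_smul_mem_base {m : ℕ} {g : G} {s : TranslatePoint G}
    (h : g⁻¹ • s ∈ base G m) : ∃ x, Order.coheight x = (m : ℕ∞) ∧ s = mk g x := by
  obtain ⟨x, hx, h⟩ := h
  refine ⟨x, hx, ?_⟩
  rw [← smul_inv_smul g s, h, smul_mk, mul_one]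

lemma encard_translate_le (g : G) (m : ℕ) :
    {s | g⁻¹ • s ∈ base G m ∧ s ∉ base G m}.encard ≤ ((g : Bir X).excPoints m).encard := by
  refine encard_le_of_rel (R := fun s x => s = mk g x) ?_ fun _ _ _ h h' => h.trans h'.symm
  rintro s ⟨hs, hs'⟩
  obtain ⟨x, hx, rfl⟩ := exists_of_inv_smul_mem_base hs
  refine ⟨x, ⟨by_contra fun h => hs' ?_, hx⟩, rfl⟩
  obtain ⟨y, hy⟩ := notMem_exc_iff.mp h
  refine ⟨y, hy.coheight_eq ▸ hx, mk_eq_mk_iff.mpr ?_⟩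
  rwa [OneMemClass.coe_one, inv_one, one_mul]

/-- The relation that `f : X ⇢ Y`, seen as a map from a translate of `X`, is a local isomorphism at
the point `s` mapping it to `y`. -/
def Marks (f : BirationalMap X Y) (s : TranslatePoint G) (y : Y.toScheme) : Prop :=
  ∃ g x, s = mk g x ∧ ((g : Bir X).trans f).Rel x y

lemma marks_mk_iff {f : BirationalMap X Y} {g : G} {x : X.toScheme} {y : Y.toScheme} :
    Marks f (mk g x) y ↔ ((g : Bir X).trans f).Rel x y := by
  refine ⟨?_, fun h => ⟨g, x, rfl, h⟩⟩
  rintro ⟨g', x', h, h'⟩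
  have := (mk_eq_mk_iff.mp h).trans h'
  change (((g : Bir X).trans (g' : Bir X).symm).trans ((g' : Bir X).trans f)).Rel x y at this
  rwa [trans_assoc, ← trans_assoc (g' : Bir X).symm, symm_trans_self, refl_trans] at this

lemma marks_mk_one_iff {f : BirationalMap X Y} {x : X.toScheme} {y : Y.toScheme} :
    Marks f (mk (1 : G) x) y ↔ f.Rel x y :=
  marks_mk_iff.trans (by rw [show ((1 : G) : Bir X).trans f = f from refl_trans f])

lemma Marks.unique {f : BirationalMap X Y} {s : TranslatePoint G} {y y' : Y.toScheme}
    (h : Marks f s y) (h' : Marks f s y') : y = y' := by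
  obtain ⟨g, x, rfl⟩ := mk_surjective s
  exact (marks_mk_iff.mp h).unique (marks_mk_iff.mp h')

lemma Marks.trans {f : BirationalMap X Y} {i : BirationalMap Y Z} {s : TranslatePoint G}
    {y : Y.toScheme} {z : Z.toScheme} (h : Marks f s y) (h' : i.Rel y z) :
    Marks (f.trans i) s z := by
  obtain ⟨g, x, rfl⟩ := mk_surjective s
  rw [marks_mk_iff] at *
  exact trans_assoc (g : Bir X) f i ▸ h.trans h'

/-- Any two elements of `B` are points of codimension `m` of a common translate of `X`. -/
def IsCompatible (m : ℕ) (B : Set (TranslatePoint G)) : Prop :=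
  ∀ a ∈ B, ∀ b ∈ B, ∃ g : G, g⁻¹ • a ∈ base G m ∧ g⁻¹ • b ∈ base G m

lemma IsCompatible.coheight_eq {m : ℕ} {B : Set (TranslatePoint G)} (hB : IsCompatible m B)
    {f : BirationalMap X Y} {s : TranslatePoint G} (hs : s ∈ B) {y : Y.toScheme}
    (h : Marks f s y) : Order.coheight y = (m : ℕ∞) := by
  obtain ⟨g, hg, -⟩ := hB s hs s hs
  obtain ⟨x, hx, rfl⟩ := exists_of_inv_smul_mem_base hg
  rw [← hx, (marks_mk_iff.mp h).coheight_eq]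

/-- The points of codimension at most `l` of `Y`, and those of codimension `l + 1` marked by `B`. -/
def good (l : ℕ) (f : BirationalMap X Y) (B : Set (TranslatePoint G)) : Set Y.toScheme :=
  {y | Order.coheight y ≤ (l : ℕ∞) ∨ ∃ s ∈ B, Marks f s y}

/-- The points of codimension `l + 1` of `Y` that are not marked by `B`. -/
def bad (l : ℕ) (f : BirationalMap X Y) (B : Set (TranslatePoint G)) : Set Y.toScheme :=
  {y | Order.coheight y = ((l + 1 : ℕ) : ℕ∞) ∧ ∀ s ∈ B, ¬ Marks f s y}

lemma nonempty_good (f : BirationalMap X Y) (B : Set (TranslatePoint G)) :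
    (good l f B).Nonempty :=
  ⟨_, Or.inl (coheight_genericPoint.trans_le zero_le)⟩

lemma coheight_le_of_specializes {y y' : Y.toScheme} (h : y' ⤳ y) (hne : y' ≠ y)
    (hy : Order.coheight y ≤ ((l + 1 : ℕ) : ℕ∞)) : Order.coheight y' ≤ (l : ℕ∞) := by
  have := (coheight_add_one_le_of_specializes h hne).trans hy
  push_cast at this
  exact (ENat.add_le_add_iff_right ENat.one_ne_top).mp this

lemma IsCompatible.good_of_specializes {B : Set (TranslatePoint G)} (hB : IsCompatible (l + 1) B)
    {f : BirationalMap X Y} (y : Y.toScheme) (hy : y ∈ good l f B) (y' : Y.toScheme)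
    (h : y' ⤳ y) : y' ∈ good l f B := by
  obtain rfl | hne := eq_or_ne y' y
  · exact hy
  · refine Or.inl (coheight_le_of_specializes h hne ?_)
    obtain hy | ⟨s, hs, hy⟩ := hy
    · exact hy.trans (by simp)
    · exact (hB.coheight_eq hs hy).le

lemma disjoint_good_bad (f : BirationalMap X Y) (B : Set (TranslatePoint G)) :
    Disjoint (good l f B) (bad l f B) := by
  rw [Set.disjoint_left]
  rintro y (hy | ⟨s, hs, hy⟩) ⟨h, h'⟩
  · rw [h, ENat.natCast_le_natCast] at hy
    omega
  · exact h' s hs hy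

lemma finite_bad {f : BirationalMap X Y} (hf : f.IsIsoInCodim l) {B : Set (TranslatePoint G)}
    (hB : (base G (l + 1) \ B).Finite) : (bad l f B).Finite := by
  have hT : {y : Y.toScheme | ∃ s ∈ base G (l + 1) \ B, Marks f s y}.Finite := by
    rw [← Set.encard_lt_top_iff] at *
    exact (encard_le_of_rel (R := fun y s => Marks f s y) (fun _ h => h)
      fun _ _ _ h h' => h.unique h').trans_lt hB
  refine (hf.symm.finite_excPoints.union hT).subset fun y hy => or_iff_not_imp_left.mpr fun h => ?_
  obtain ⟨x, hx⟩ := notMem_exc_iff.mp fun h' => h ⟨h', hy.1⟩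
  have hm : Marks f (mk (1 : G) x) y := marks_mk_one_iff.mpr hx.symm
  exact ⟨mk 1 x, ⟨⟨x, hx.coheight_eq ▸ hy.1, rfl⟩, fun hs => hy.2 _ hs hm⟩, hm⟩

lemma rel_of_mem_closure_of_good {B : Set (TranslatePoint G)} (hB : IsCompatible (l + 1) B)
    {f₁ : BirationalMap X Y} {f₂ : BirationalMap X Z} (h₁ : f₁.IsIsoInCodim l)
    (h₂ : f₂.IsIsoInCodim l) (c : (f₁.symm.trans f₂).Chart)
    (z : (Limits.pullback Y.str Z.str :)) (hz : z ∈ closure (Set.range c.graph))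
    (hp : Limits.pullback.fst Y.str Z.str z ∈ good l f₁ B)
    (hq : Limits.pullback.snd Y.str Z.str z ∈ good l f₂ B) :
    (f₁.symm.trans f₂).Rel (Limits.pullback.fst Y.str Z.str z)
      (Limits.pullback.snd Y.str Z.str z) := by
  have hφ := isIsoInCodim_iff.mp (h₁.symm.trans h₂)
  obtain hp | ⟨s, hs, hp⟩ := hp
  · obtain ⟨y, hy⟩ := hφ.1 _ hp
    exact c.rel_of_mem_closure (trans_refl _) hz hy (rel_refl _)
  obtain hq | ⟨t, ht, hq⟩ := hq
  · obtain ⟨y, hy⟩ := hφ.2 _ hq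
    exact c.rel_of_mem_closure (self_trans_symm _) hz (rel_refl _) hy
  obtain ⟨g, hgs, hgt⟩ := hB s hs t ht
  obtain ⟨x, -, rfl⟩ := exists_of_inv_smul_mem_base hgs
  obtain ⟨x', -, rfl⟩ := exists_of_inv_smul_mem_base hgt
  have e : (f₁.symm.trans f₂).trans (f₂.symm.trans (g : Bir X).symm) =
      f₁.symm.trans (g : Bir X).symm := by
    rw [trans_assoc, ← trans_assoc f₂, self_trans_symm, refl_trans]
  exact c.rel_of_mem_closure e hz (marks_mk_iff.mp hp).symm (marks_mk_iff.mp hq).symm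

/-- Two models of `X` can be combined to a model all of whose points of codimension `l + 1` are
marked by `B`, and that has all points marked by `B` of the two models. -/
lemma exists_combined_model {B : Set (TranslatePoint G)} (hB : IsCompatible (l + 1) B)
    (hAB : (base G (l + 1) \ B).Finite) {f₁ : BirationalMap X Y} {f₂ : BirationalMap X Z}
    (h₁ : f₁.IsIsoInCodim l) (h₂ : f₂.IsIsoInCodim l) :
    ∃ (W : Variety k) (h : BirationalMap X W), h.IsIsoInCodim l ∧
      (∀ w, Order.coheight w = ((l + 1 : ℕ) : ℕ∞) → ∃ s ∈ B, Marks h s w) ∧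
      ∀ s ∈ B, ((∃ y, Marks f₁ s y) ∨ ∃ z, Marks f₂ s z) → ∃ w, Marks h s w := by
  have hφ := isIsoInCodim_iff.mp (h₁.symm.trans h₂)
  have hne : (f₁.symm.trans f₂).excᶜ.Nonempty :=
    ⟨_, notMem_exc_iff.mpr (hφ.1 _ (coheight_genericPoint.trans_le zero_le))⟩
  obtain ⟨W, i, j, rfl, hi, hj, hW⟩ := (f₁.symm.trans f₂).exists_glue hne
    (nonempty_good f₁ B) (nonempty_good f₂ B) hB.good_of_specializes hB.good_of_specializes
    (finite_bad h₁ hAB) (finite_bad h₂ hAB) (disjoint_good_bad f₁ B) (disjoint_good_bad f₂ B)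
    (rel_of_mem_closure_of_good hB h₁ h₂)
  have e : f₁.trans ((f₁.symm.trans f₂).trans j) = f₂.trans j := by
    rw [trans_assoc, ← trans_assoc f₁, self_trans_symm, refl_trans]
  have h₁' := isIsoInCodim_iff.mp h₁
  have h₂' := isIsoInCodim_iff.mp h₂
  refine ⟨W, f₂.trans j, isIsoInCodim_iff.mpr ⟨fun x hx => ?_, fun w hw => ?_⟩, fun w hw => ?_,
    fun s hs => ?_⟩
  · obtain ⟨z, hz⟩ := h₂'.1 x hx
    obtain ⟨w, hw⟩ := hj z (Or.inl (hz.coheight_eq ▸ hx))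
    exact ⟨w, hz.trans hw⟩
  · obtain ⟨y, -, hy⟩ | ⟨z, -, hz⟩ := hW w
    · obtain ⟨x, hx⟩ := h₁'.2 y (hy.coheight_eq.trans_le hw)
      exact ⟨x, (e ▸ hx.symm.trans hy : (f₂.trans j).Rel x w).symm⟩
    · obtain ⟨x, hx⟩ := h₂'.2 z (hz.coheight_eq.trans_le hw)
      exact ⟨x, (hx.symm.trans hz).symm⟩
  · obtain ⟨y, hy', hy⟩ | ⟨z, hz', hz⟩ := hW w
    · have : ∃ s ∈ B, Marks f₁ s y := by
        by_contra! h
        exact hy' ⟨hy.coheight_eq.trans hw, h⟩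
      obtain ⟨s, hs, hsy⟩ := this
      exact ⟨s, hs, e ▸ hsy.trans hy⟩
    · have : ∃ s ∈ B, Marks f₂ s z := by
        by_contra! h
        exact hz' ⟨hz.coheight_eq.trans hw, h⟩
      obtain ⟨s, hs, hsz⟩ := this
      exact ⟨s, hs, hsz.trans hz⟩
  · rintro (⟨y, hy⟩ | ⟨z, hz⟩)
    · obtain ⟨w, hw⟩ := hi y (Or.inr ⟨s, hs, hy⟩)
      exact ⟨w, e ▸ hy.trans hw⟩
    · obtain ⟨w, hw⟩ := hj z (Or.inr ⟨s, hs, hz⟩)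
      exact ⟨w, hz.trans hw⟩

/-- There is a model of `X` whose points of codimension `l + 1` are the elements of `B`. -/
lemma exists_model (hG : (G : Set (Bir X)) ⊆ Psaut l X) {B : Set (TranslatePoint G)}
    (hB : IsCompatible (l + 1) B) (hAB : (base G (l + 1) \ B).Finite)
    (hBA : (B \ base G (l + 1)).Finite) :
    ∃ (W : Variety k) (h : BirationalMap X W), h.IsIsoInCodim l ∧
      (∀ w, Order.coheight w = ((l + 1 : ℕ) : ℕ∞) → ∃ s ∈ B, Marks h s w) ∧
      ∀ s ∈ B, ∃ w, Marks h s w := by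
  have key : ∀ T ⊆ B \ base G (l + 1), T.Finite →
      ∃ (W : Variety k) (h : BirationalMap X W), h.IsIsoInCodim l ∧
        (∀ w, Order.coheight w = ((l + 1 : ℕ) : ℕ∞) → ∃ s ∈ B, Marks h s w) ∧
        ∀ s ∈ B, s ∈ base G (l + 1) ∨ s ∈ T → ∃ w, Marks h s w := by
    intro T hT hfin
    induction T, hfin using Set.Finite.induction_on with
    | empty =>
      obtain ⟨W, h, h₁, h₂, h₃⟩ := exists_combined_model hB hAB
        (isIsoInCodim_refl (X := X) (l := l)) isIsoInCodim_refl
      refine ⟨W, h, h₁, h₂, fun s hs hs' => h₃ s hs (Or.inl ?_)⟩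
      obtain ⟨x, -, rfl⟩ := hs'.resolve_right (Set.notMem_empty s)
      exact ⟨x, marks_mk_one_iff.mpr (rel_refl x)⟩
    | @insert a T _ _ ih =>
      obtain ⟨Y, f, h₁, h₂, h₃⟩ := ih ((Set.subset_insert a T).trans hT)
      obtain ⟨g, x, rfl⟩ := mk_surjective a
      obtain ⟨W, h, h₁', h₂', h₃'⟩ := exists_combined_model hB hAB h₁
        (IsIsoInCodim.symm (hG g.2))
      refine ⟨W, h, h₁', h₂', fun s hs hs' => h₃' s hs ?_⟩
      obtain hs' | rfl | hs' := hs'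
      · exact Or.inl (h₃ s hs (Or.inl hs'))
      · refine Or.inr ⟨x, marks_mk_iff.mpr ?_⟩
        rw [self_trans_symm]
        exact rel_refl x
      · exact Or.inl (h₃ s hs (Or.inr hs'))
  obtain ⟨W, h, h₁, h₂, h₃⟩ := key _ subset_rfl hBA
  exact ⟨W, h, h₁, h₂, fun s hs => h₃ s hs (or_iff_not_imp_left.mpr fun hs' => ⟨hs, hs'⟩)⟩

lemma exists_conj_rel (hG : (G : Set (Bir X)) ⊆ Psaut l X) {B : Set (TranslatePoint G)}
    (hB : ∀ (g : G), ∀ s ∈ B, g • s ∈ B) {f : BirationalMap X Y} (hf : f.IsIsoInCodim l)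
    (h₁ : ∀ y, Order.coheight y = ((l + 1 : ℕ) : ℕ∞) → ∃ s ∈ B, Marks f s y)
    (h₂ : ∀ s ∈ B, ∃ y, Marks f s y) (g : G) {y : Y.toScheme}
    (hy : Order.coheight y ≤ ((l + 1 : ℕ) : ℕ∞)) : ∃ y', (f.conj g).Rel y y' := by
  obtain hy | hy := hy.lt_or_eq
  · have hg : (g : Bir X).IsIsoInCodim l := hG g.2
    refine (isIsoInCodim_iff.mp (hf.symm.trans (hg.trans hf))).1 y ?_
    push_cast at hy
    exact Order.le_of_lt_add_one hy
  · obtain ⟨s, hs, hsy⟩ := h₁ y hy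
    obtain ⟨y', hy'⟩ := h₂ (g • s) (hB g s hs)
    obtain ⟨a, x, rfl⟩ := mk_surjective s
    rw [smul_mk, marks_mk_iff] at hy'
    refine ⟨y', ?_⟩
    have := (marks_mk_iff.mp hsy).symm.trans hy'
    have e : ((a : Bir X).trans f).symm.trans (((g * a : G) : Bir X).trans f) = f.conj g := by
      change (f.symm.trans (a : Bir X).symm).trans (((a : Bir X).trans (g : Bir X)).trans f) = _
      rw [conj, trans_assoc, ← trans_assoc (a : Bir X).symm, ← trans_assoc (a : Bir X).symm,
        symm_trans_self, refl_trans]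
    rwa [e] at this

end TranslatePoint

end BirGeom

theorem mainTheorem10 {k : Type u} [Field k] (X : BirGeom.Variety k) (l : ℕ)
    (hl : ((l + 1 : ℕ) : WithBot ℕ∞) ≤ topologicalKrullDim X.toScheme)
    (G : Subgroup (BirGeom.Bir X)) (hG : (G : Set (BirGeom.Bir X)) ⊆ BirGeom.Psaut l X) :
    BirGeom.IsPseudoRegularizableBy (l + 1) l G ↔
      ∃ N : ℕ, ∀ g ∈ G, (BirGeom.BirationalMap.excComponents (l + 1) g).encard ≤ N := by
  open BirGeom BirationalMap TranslatePoint in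
  constructor
  · rintro ⟨Y, f, hf, h⟩
    refine ⟨(f.excPoints (l + 1)).ncard + (f.symm.excPoints (l + 1)).ncard, fun g hg => ?_⟩
    rw [IsIsoInCodim.encard_excComponents (hG hg), Nat.cast_add,
      hf.finite_excPoints.cast_ncard_eq, hf.symm.finite_excPoints.cast_ncard_eq]
    exact encard_excPoints_le (h g hg)
  · rintro ⟨N, hN⟩
    obtain ⟨B, hB, hAB, hBA, hcomp⟩ := exists_invariant_commensurate (base G (l + 1)) N
      fun g => (encard_translate_le g (l + 1)).trans
        ((IsIsoInCodim.encard_excComponents (hG g.2)).symm.trans_le (hN g g.2))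
    obtain ⟨Y, f, hf, h₁, h₂⟩ := exists_model hG hcomp hAB hBA
    refine ⟨Y, f, hf, fun g hg => isIsoInCodim_iff.mpr ⟨fun y hy => ?_, fun y hy => ?_⟩⟩
    · exact exists_conj_rel hG hB hf h₁ h₂ ⟨g, hg⟩ hy
    · obtain ⟨y', hy'⟩ := exists_conj_rel hG hB hf h₁ h₂ (⟨g, hg⟩ : G)⁻¹ hy
      refine ⟨y', ?_⟩
      rwa [show (f.conj g).symm = f.conj ((⟨g, hg⟩ : G)⁻¹ : G) from
        trans_assoc f.symm (BirationalMap.symm g) f]
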